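/- Let $d\ge 1$ be an integer and $\alpha\in(0,1)$. For $u\in\ell^2(\mathbb Z^d)$ (real-valued) let $\hat u(\theta)=\sum_{x\in\mathbb Z^d}u(x)e^{ix\cdot\theta}$ (convergence in $L^2([-\pi,\pi]^d)$) be its discrete Fourier transform, let $\Phi(\theta)=\sum_{i=1}^d 4\sin^2(\theta_i/2)$, and let $(-\Delta)^\alpha u$ be the function on $\mathbb Z^d$ whose Fourier transform is $\Phi^\alpha\hat u$, i.e. $$(-\Delta)^\alpha u(x)=\frac1{(2\pi)^d}\int_{[-\pi,\pi]^d}\Phi(\theta)^\alpha\,\hat u(\theta)\,e^{-ix\cdot\theta}\,d\theta .$$ Let $h:\mathbb Z^d\to\mathbb R$ and $f:\mathbb Z^d\times\mathbb R\to\mathbb R$, and put $F(x,u)=\int_0^u f(x,t)\,dt$. Assume: - ($h_1$) there are constants $c_1,c_2>0$ with $c_1\le h(x)\le c_2$ for all $x\in\mathbb Z^d$; - ($f_1$) $f(x,\cdot)$ is continuous on $\mathbb R$ for every $x$; - ($f_2$) there are $a>0$ and $p>2$ with $|f(x,u)|\le a(1+|u|^{p-1})$ for all $x,u$; - ($f_3$)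 $f(x,u)=o(u)$ as $|u|\to0$, uniformly in $x$; - ($f_4$) for every $x$, $u\mapsto f(x,u)/|u|$ is strictly increasing on $(-\infty,0)$ and on $(0,+\infty)$; - ($f_5$) $F(x,u)/u^2\to+\infty$ as $|u|\to+\infty$, uniformly in $x$; - ($f_6$) $h$ and $f$ are $1$-periodic in each coordinate $x_i$ of $x$, $1\le i\le d$; - $f$ is odd in $u$: $f(x,-u)=-f(x,u)$ for all $x,u$. Let $H^\alpha=\{u\in\ell^2(\mathbb Z^d):(2\pi)^{-d}\int_{[-\pi,\pi]^d}\Phi^\alpha|\hat u|^2\,d\theta+\sum_{x}h(x)|u(x)|^2<+\infty\}$, and let $\mathcal O(u)=\{u(\cdot-y):y\in\mathbb Z^d\}$ be the translation orbit of $u$. Then the equation $$(-\Delta)^\alpha u+h(x)u=f(x,u),\qquad x\in\mathbb Z^d,$$ has infinitely many pairs of geometrically distinct solutions in $H^\alpha$: there is a sequence $(u_n)_{n\in\mathbb N}$ of nonzero elements of $H^\alpha$ such that all the functions $u_n$ and $-u_n$ are solutions in $H^\alpha$, and all the orbits $\mathcal O(u_n),\ \mathcal O(-u_n)$, $n\in\mathbb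 N$, are pairwise disjoint. -/

import Mathlib

open MeasureTheory Set

noncomputable section

namespace DiscreteFractional

/-- The integer lattice `ℤ^d`. -/
abbrev Lattice (d : ℕ) : Type := Fin d → ℤ

/-- The real sequence space `ℓ²(ℤ^d)`. -/
abbrev Ell2 (d : ℕ) : Type := lp (fun _ : Lattice d => ℝ) 2

/-- The frequency cube `[-π, π]^d`. -/
def cube (d : ℕ) : Set (Fin d → ℝ) := Icc (fun _ => -Real.pi) (fun _ => Real.pi)

/-- Lebesgue measure on `[-π, π]^d`. -/
abbrev cubeMeasure (d : ℕ) : Measure (Fin d → ℝ) := volume.restrict (cube d)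

/-- The pairing `x · θ = ∑ xᵢ θᵢ`. -/
def pairing {d : ℕ} (x : Lattice d) (θ : Fin d → ℝ) : ℝ := ∑ i, (x i : ℝ) * θ i

/-- The character `θ ↦ e^{i x·θ}`. -/
def character {d : ℕ} (x : Lattice d) (θ : Fin d → ℝ) : ℂ :=
  Complex.exp (Complex.I * (pairing x θ : ℂ))

theorem memLp_character {d : ℕ} (x : Lattice d) :
    MemLp (character x) 2 (cubeMeasure d) := by
  have hfin : IsFiniteMeasure (cubeMeasure d) :=
    ⟨by
      rw [Measure.restrict_apply_univ]
      exact isCompact_Icc.measure_lt_top⟩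
  have hc : Continuous (character x) := by
    unfold character pairing
    fun_prop
  refine MemLp.of_bound hc.aestronglyMeasurable 1 (Filter.Eventually.of_forall fun θ => ?_)
  rw [character, mul_comm, Complex.norm_exp_ofReal_mul_I]

/-- The discrete Fourier transform `û = ∑ₓ u(x) e^{i x·θ}` of `u ∈ ℓ²(ℤ^d)`, the series being
summed in `L²([-π, π]^d)`. This is the continuous extension to `ℓ²` of the transform on `ℓ¹`. -/
def fourier {d : ℕ} (u : Ell2 d) : Lp ℂ 2 (cubeMeasure d) :=
  ∑' x : Lattice d, (u x : ℂ) • (memLp_character x).toLp (character x)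

/-- The inverse discrete Fourier transform
`(2π)^{-d} ∫_{[-π,π]^d} v(θ) e^{-i x·θ} dθ`. -/
def fourierInv {d : ℕ} (v : (Fin d → ℝ) → ℂ) (x : Lattice d) : ℂ :=
  (1 / (2 * Real.pi : ℂ) ^ d) *
    ∫ θ in cube d, v θ * Complex.exp (-(Complex.I * (pairing x θ : ℂ)))

/-- The symbol `Φ(θ) = ∑ᵢ 4 sin²(θᵢ / 2)` of the lattice Laplacian `-Δ`. -/
def symbol {d : ℕ} (θ : Fin d → ℝ) : ℝ := ∑ i, 4 * Real.sin (θ i / 2) ^ 2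

/-- The discrete fractional Laplacian: `(-Δ)^α u` is the function on `ℤ^d` with Fourier transform
`Φ^α û`. It is real for real `u`, but the Fourier formula computes it in `ℂ`. -/
def fracLaplacian {d : ℕ} (α : ℝ) (u : Ell2 d) (x : Lattice d) : ℂ :=
  fourierInv (fun θ => ((symbol θ ^ α : ℝ) : ℂ) * fourier u θ) x

/-- The space `H^α`: those `u ∈ ℓ²(ℤ^d)` for which both (nonnegative) terms of
`(2π)^{-d} ∫ Φ^α |û|² dθ + ∑ₓ h(x) |u(x)|²` are finite. -/
def HAlpha {d : ℕ} (α : ℝ) (h : Lattice d → ℝ) : Set (Ell2 d) :=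
  {u | IntegrableOn (fun θ => symbol θ ^ α * ‖fourier u θ‖ ^ 2) (cube d) ∧
    Summable fun x => h x * |u x| ^ 2}

/-- `u` solves `(-Δ)^α u + h(x) u = f(x, u)` at every point of `ℤ^d`. -/
def IsSolution {d : ℕ} (α : ℝ) (h : Lattice d → ℝ) (f : Lattice d → ℝ → ℝ) (u : Ell2 d) : Prop :=
  ∀ x : Lattice d, fracLaplacian α u x + ((h x * u x : ℝ) : ℂ) = ((f x (u x) : ℝ) : ℂ)

/-- The orbit `{u(· - y) : y ∈ ℤ^d}` of `u` under lattice translations. -/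
def orbit {d : ℕ} (u : Ell2 d) : Set (Lattice d → ℝ) :=
  range fun (y : Lattice d) (x : Lattice d) => u (x - y)

/-- Two functions are geometrically distinct if their translation orbits are disjoint. -/
def GeometricallyDistinct {d : ℕ} (u v : Ell2 d) : Prop := Disjoint (orbit u) (orbit v)

end DiscreteFractional

end

/-!
By periodicity `h` and `f` do not depend on `x`, so the equation reads `T u = u g(u)` with
`T = (-Δ)^α + c` symmetric, coercive and commuting with translations, and with
`g(s) = f(s) / s` even, continuous and increasing on `[0, ∞)`.

Each ray meets the Nehari set once, which identifies this set with the unit sphere of `ℓ²`. The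
fixed point iteration `u ↦ T⁻¹ (u g(u))`, projected radially, becomes an odd continuous self-map of
the sphere. It fixes exactly the critical points, and lowers the action by at least a constant times
the squared distance travelled: as a function of `s²`, the primitive `F(s)` is convex, so it lies
above its tangents.

Suppose that there are finitely many critical orbits up to translation. Since `ℓ²` sequences
decay, distinct critical points are then uniformly separated on the sphere, and almost critical
points on a sublevel set of the action gather in uniformly separated small clusters. Iterating the
map carries any compact symmetric set from above a critical level to below it, apart from a set of
genus at most one. Hence every compact symmetric subset of the sphere has genus at most the finite
number of critical values. By the Lusternik–Schnirelmann theorem, the unit spheres of large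
finite-dimensional subspaces have larger genus.
-/

noncomputable section

/-! ### Chains modulo two -/

/-- Augmented ordered simplicial chains modulo two, with vertices in `X`. A list of `k + 1`
vertices, possibly with repetitions, stands for an ordered `k`-simplex, and the empty list spans
degree `-1`. -/
abbrev ModTwoChain (X : Type*) : Type _ := List X →₀ ZMod 2

namespace ModTwoChain

variable {X Y Z M : Type*} [AddCommGroup M] [Module (ZMod 2) M]

/-- An ordered simplex, regarded as a chain. -/
def simplex (l : List X) : ModTwoChain X := Finsupp.single l 1

/-- The linear extension to chains of a map given on simplices. For values in `ZMod 2` this is the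
evaluation of a cochain. -/
def extend (φ : List X → M) : ModTwoChain X →ₗ[ZMod 2] M := Finsupp.linearCombination (ZMod 2) φ

/-- The cone over a chain with apex `v`, which becomes the first vertex of each simplex. -/
def cone (v : X) : ModTwoChain X →ₗ[ZMod 2] ModTwoChain X :=
  Finsupp.lmapDomain (ZMod 2) (ZMod 2) (List.cons v)

/-- The chain map induced by a map of vertices. -/
def push (h : X → Y) : ModTwoChain X →ₗ[ZMod 2] ModTwoChain Y :=
  Finsupp.lmapDomain (ZMod 2) (ZMod 2) (List.map h)

/-- The boundary of a simplex, by recursion on the number of vertices. -/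
def simplexBoundary : List X → ModTwoChain X
  | [] => 0
  | v :: l => simplex l + cone v (simplexBoundary l)

/-- The boundary operator of the augmented chain complex. -/
def boundary : ModTwoChain X →ₗ[ZMod 2] ModTwoChain X := extend simplexBoundary

/-- The standard triangulation of the prism over a simplex, with bottom mapped by `h` and top
mapped by `h'`. -/
def simplexPrism (h h' : X → Y) : List X → ModTwoChain Y
  | [] => 0
  | v :: l => simplex (h v :: h' v :: l.map h') + cone (h v) (simplexPrism h h' l)

/-- The prism operator, a chain homotopy between `push h` and `push h'`. -/
def prism (h h' : X → Y) : ModTwoChain X →ₗ[ZMod 2] ModTwoChain Y := extend (simplexPrism h h')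

/-- The chains all of whose simplices lie in `s`. -/
abbrev supportedOn (s : Set (List X)) : Submodule (ZMod 2) (ModTwoChain X) :=
  Finsupp.supported (ZMod 2) (ZMod 2) s

@[simp]
theorem extend_simplex (φ : List X → M) (l : List X) : extend φ (simplex l) = φ l := by
  simp [extend, simplex]

@[simp]
theorem cone_simplex (v : X) (l : List X) : cone v (simplex l) = simplex (v :: l) := by
  simp [cone, simplex]

@[simp]
theorem push_simplex (h : X → Y) (l : List X) : push h (simplex l) = simplex (l.map h) := by
  simp [push, simplex]

@[simp]
theorem boundary_simplex_nil : boundary (simplex ([] : List X)) = 0 := by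
  simp [boundary, simplexBoundary]

@[simp]
theorem prism_simplex_nil (h h' : X → Y) : prism h h' (simplex []) = 0 := by
  simp [prism, simplexPrism]

theorem simplex_mem_supportedOn {s : Set (List X)} {l : List X} (hl : l ∈ s) :
    simplex l ∈ supportedOn s :=
  Finsupp.single_mem_supported _ _ hl

theorem map_mem_of_mem_supportedOn {s : Set (List X)} {S : Submodule (ZMod 2) M}
    {f : ModTwoChain X →ₗ[ZMod 2] M} (h : ∀ l ∈ s, f (simplex l) ∈ S) {c : ModTwoChain X}
    (hc : c ∈ supportedOn s) : f c ∈ S := by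
  have hspan : supportedOn s ≤ S.comap f := by
    rw [supportedOn, Finsupp.supported_eq_span_single, Submodule.span_le]
    rintro _ ⟨l, hl, rfl⟩
    exact h l hl
  exact hspan hc

theorem map_eq_of_mem_supportedOn {s : Set (List X)} {f g : ModTwoChain X →ₗ[ZMod 2] M}
    (h : ∀ l ∈ s, f (simplex l) = g (simplex l)) {c : ModTwoChain X} (hc : c ∈ supportedOn s) :
    f c = g c := by
  have hsub : (f - g) c ∈ (⊥ : Submodule (ZMod 2) M) :=
    map_mem_of_mem_supportedOn (fun l hl => by simp [h l hl]) hc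
  simpa [sub_eq_zero] using hsub

theorem map_eq_of_simplex {f g : ModTwoChain X →ₗ[ZMod 2] M}
    (h : ∀ l, f (simplex l) = g (simplex l)) (c : ModTwoChain X) : f c = g c :=
  map_eq_of_mem_supportedOn (s := Set.univ) (fun l _ => h l) (by simp)

theorem extend_cone (φ : List X → M) (v : X) (c : ModTwoChain X) :
    extend φ (cone v c) = extend (fun l => φ (v :: l)) c :=
  map_eq_of_simplex (f := extend φ ∘ₗ cone v) (fun l => by simp) c

theorem extend_mul_left (a : ZMod 2) (φ : List X → ZMod 2) (c : ModTwoChain X) :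
    extend (fun l => a * φ l) c = a * extend φ c :=
  map_eq_of_simplex (g := a • extend φ) (fun l => by simp) c

theorem push_push (h : X → Y) (k : Y → Z) (c : ModTwoChain X) :
    push k (push h c) = push (k ∘ h) c :=
  map_eq_of_simplex (f := push k ∘ₗ push h) (fun l => by simp) c

theorem push_eq_self {h : X → X} (hh : ∀ x, h x = x) (c : ModTwoChain X) : push h c = c :=
  map_eq_of_simplex (g := LinearMap.id) (fun l => by simp [funext hh]) c

theorem push_cone (h : X → Y) (v : X) (c : ModTwoChain X) :
    push h (cone v c) = cone (h v) (push h c) :=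
  map_eq_of_simplex (f := push h ∘ₗ cone v) (g := cone (h v) ∘ₗ push h) (fun l => by simp) c

theorem boundary_cone (v : X) (c : ModTwoChain X) :
    boundary (cone v c) = c + cone v (boundary c) :=
  map_eq_of_simplex (f := boundary ∘ₗ cone v) (g := LinearMap.id + cone v ∘ₗ boundary)
    (fun l => by simp [boundary, simplexBoundary]) c

theorem prism_cone (h h' : X → Y) (v : X) (c : ModTwoChain X) :
    prism h h' (cone v c) = cone (h v) (cone (h' v) (push h' c)) + cone (h v) (prism h h' c) :=
  map_eq_of_simplex (f := prism h h' ∘ₗ cone v)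
    (g := cone (h v) ∘ₗ cone (h' v) ∘ₗ push h' + cone (h v) ∘ₗ prism h h')
    (fun l => by simp [prism, simplexPrism]) c

theorem map_eq_of_cone {f g : ModTwoChain X →ₗ[ZMod 2] M}
    (hnil : f (simplex []) = g (simplex []))
    (hcone : ∀ v c, f c = g c → f (cone v c) = g (cone v c)) (c : ModTwoChain X) : f c = g c := by
  refine map_eq_of_simplex (fun l => ?_) c
  induction l with
  | nil => exact hnil
  | cons v l ih => simpa using hcone v _ ih

theorem boundary_push (h : X → Y) (c : ModTwoChain X) : boundary (push h c) = push h (boundary c) :=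
  map_eq_of_cone (f := boundary ∘ₗ push h) (g := push h ∘ₗ boundary) (by simp)
    (fun v c (ih : boundary (push h c) = push h (boundary c)) => by
      simp [push_cone, boundary_cone, ih]) c

theorem boundary_prism (h h' : X → Y) (c : ModTwoChain X) :
    boundary (prism h h' c) + prism h h' (boundary c) = push h c + push h' c := by
  refine map_eq_of_cone (f := boundary ∘ₗ prism h h' + prism h h' ∘ₗ boundary)
    (g := push h + push h') (by simp [ZModModule.add_self]) (fun v c ih => ?_) c
  replace ih : boundary (prism h h' c) + prism h h' (boundary c) = push h c + push h' c := ih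
  have hcone := congrArg (cone (h v)) ih
  simp only [LinearMap.add_apply, LinearMap.comp_apply, prism_cone, boundary_cone, push_cone,
    boundary_push, map_add] at hcone ⊢
  linear_combination (norm := module) hcone + ZModModule.add_self (prism h h' c) +
    ZModModule.add_self (cone (h v) (push h' c)) +
    ZModModule.add_self (cone (h v) (cone (h' v) (push h' (boundary c))))

theorem boundary_sum_prism (h : ℕ → X → Y) {z : ModTwoChain X} (hz : boundary z = 0) (N : ℕ) :
    boundary (∑ j ∈ Finset.range N, prism (h j) (h (j + 1)) z) = push (h 0) z + push (h N) z := by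
  induction N with
  | zero => simp [ZModModule.add_self]
  | succ N ih =>
    have hstep : boundary (prism (h N) (h (N + 1)) z) = push (h N) z + push (h (N + 1)) z := by
      simpa [hz] using boundary_prism (h N) (h (N + 1)) z
    rw [Finset.sum_range_succ, map_add, ih, hstep, ZModModule.add_add_add_cancel]

theorem prism_simplex_mem_supportedOn (h h' : X → Y) (l : List X) :
    prism h h' (simplex l) ∈
      supportedOn {m | m.length = l.length + 1 ∧ ∀ v ∈ m, ∃ x ∈ l, v = h x ∨ v = h' x} := by
  induction l with
  | nil => simp
  | cons a l ih =>
    rw [← cone_simplex, prism_cone, push_simplex, cone_simplex, cone_simplex]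
    refine Submodule.add_mem _ (simplex_mem_supportedOn ⟨by simp, by simp; grind⟩)
      (map_mem_of_mem_supportedOn (fun m hm => ?_) ih)
    rw [cone_simplex]
    exact simplex_mem_supportedOn ⟨by simp [hm.1], by simp; grind⟩

/-! ### Products of coboundaries -/

/-- The cochain `δβ_{k-1} ∪ ⋯ ∪ δβ_0` on `k`-simplices, where `δβ` is the coboundary of the
`0`-cochain `β` (with the convention that it vanishes on simplices of other dimensions). -/
def cup (β : ℕ → X → ZMod 2) : ℕ → List X → ZMod 2
  | 0, [_] => 1
  | k + 1, v :: w :: l => (β k v + β k w) * cup β k (w :: l)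
  | _, _ => 0

/-- The cochain `β_k ∪ δβ_{k-1} ∪ ⋯ ∪ δβ_0`, whose coboundary is `cup β (k + 1)`. -/
def cupPrimitive (β : ℕ → X → ZMod 2) (k : ℕ) : List X → ZMod 2
  | [] => 0
  | v :: l => β k v * cup β k (v :: l)

theorem extend_boundary_cons_cons (φ : List X → ZMod 2) (v w : X) (l : List X) :
    extend φ (boundary (simplex (v :: w :: l))) =
      φ (w :: l) + φ (v :: l) + extend (fun m => φ (v :: w :: m)) (boundary (simplex l)) := by
  simp only [← cone_simplex, boundary_cone, map_add, extend_cone, extend_simplex, add_assoc]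

theorem extend_cup_boundary (β : ℕ → X → ZMod 2) (k : ℕ) (l : List X) (hl : l.length = k + 2) :
    extend (cup β k) (boundary (simplex l)) = 0 := by
  induction k generalizing l with
  | zero =>
    obtain ⟨v, w, rfl⟩ := List.length_eq_two.1 hl
    simpa [extend_boundary_cons_cons, cup] using CharTwo.add_self_eq_zero (1 : ZMod 2)
  | succ k ih =>
    match l, hl with
    | v :: w :: x :: l, hl =>
      have hface : extend (fun m => cup β k (w :: m)) (boundary (simplex (x :: l))) =
          cup β k (x :: l) := by
        have hcocycle := ih (w :: x :: l) (by simpa using hl)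
        rw [← cone_simplex, boundary_cone, map_add, extend_simplex, extend_cone] at hcocycle
        exact (CharTwo.add_eq_zero.1 hcocycle).symm
      have hsum : ∀ a b c d : ZMod 2, (a + b) * d + (c + b) * d + (c + a) * d = 0 := by decide
      rw [extend_boundary_cons_cons]
      simp only [cup, extend_mul_left, hface]
      exact hsum _ _ _ _

theorem extend_cupPrimitive_boundary (β : ℕ → X → ZMod 2) (k : ℕ) (l : List X)
    (hl : l.length = k + 2) :
    extend (cupPrimitive β k) (boundary (simplex l)) = cup β (k + 1) l := by
  match l, hl with
  | v :: w :: l, hl =>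
    have hcocycle := extend_cup_boundary β k (v :: w :: l) hl
    have hleibniz : ∀ a b c d e : ZMod 2, c + d + e = 0 →
      b * c + a * d + a * e = (a + b) * c := by decide
    rw [extend_boundary_cons_cons] at hcocycle ⊢
    simp only [cupPrimitive, cup, extend_mul_left]
    exact hleibniz _ _ _ _ _ hcocycle

theorem cup_map_of_odd {β : ℕ → X → ZMod 2} {σ : X → X} (k : ℕ) (l : List X)
    (hβ : ∀ i, ∀ v ∈ l, β i (σ v) = β i v + 1) : cup β k (l.map σ) = cup β k l := by
  induction k generalizing l with
  | zero => rcases l with _ | ⟨v, _ | ⟨w, l⟩⟩ <;> simp [cup]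
  | succ k ih =>
    rcases l with _ | ⟨v, _ | ⟨w, l⟩⟩
    · simp [cup]
    · simp [cup]
    · have hrec := ih (w :: l) fun i x hx => hβ i x (List.mem_cons_of_mem v hx)
      have hcancel : ∀ a b : ZMod 2, a + 1 + (b + 1) = a + b := by decide
      simp only [List.map_cons, cup] at hrec ⊢
      rw [hrec, hβ k v (by simp), hβ k w (by simp), hcancel]

theorem cup_eq_zero_of_forall_eq {β : ℕ → X → ZMod 2} {i k : ℕ} (hi : i < k) {b : ZMod 2}
    (l : List X) (hl : ∀ v ∈ l, β i v = b) : cup β k l = 0 := by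
  induction k generalizing l with
  | zero => omega
  | succ k ih =>
    rcases l with _ | ⟨v, _ | ⟨w, l⟩⟩
    · simp [cup]
    · simp [cup]
    · rcases Nat.lt_succ_iff_lt_or_eq.1 hi with hlt | rfl
      · simp [cup, ih hlt (w :: l) fun x hx => hl x (List.mem_cons_of_mem v hx)]
      · simp [cup, hl v (by simp), hl w (by simp), CharTwo.add_self_eq_zero]

end ModTwoChain

/-! ### The Lusternik–Schnirelmann theorem -/

theorem exists_antipodal_half {X : Type*} [InvolutiveNeg X] {U : Set X}
    (hU : ∀ x ∈ U, -x ∉ U) : ∃ P : Set X, U ⊆ P ∧ ∀ x, -x ≠ x → (-x ∈ P ↔ x ∉ P) := by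
  -- Outside `U ∪ -U`, a well-order of `X` selects one point of each antipodal pair.
  refine ⟨{x | x ∈ U ∨ (-x ∉ U ∧ WellOrderingRel x (-x))}, fun x hx => Or.inl hx, fun x hx => ?_⟩
  have htri : WellOrderingRel x (-x) ∨ WellOrderingRel (-x) x := by
    rcases trichotomous_of WellOrderingRel x (-x) with h | h | h
    exacts [Or.inl h, absurd h.symm hx, Or.inr h]
  have hasymm : WellOrderingRel x (-x) → ¬ WellOrderingRel (-x) x := asymm_of WellOrderingRel
  have hUx := hU x
  simp only [mem_ofPred_eq, neg_neg]
  tauto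

namespace ModTwoChain

variable {E : Type*} [NormedAddCommGroup E] [InnerProductSpace ℝ E]

/-- Rotation of `x` towards `e` by the angle `t`, for orthonormal `x` and `e`. -/
def rotate (e : E) (t : ℝ) (x : E) : E := Real.cos t • x + Real.sin t • e

theorem norm_rotate {e x : E} (he : ‖e‖ = 1) (hx : ‖x‖ = 1) (hxe : inner ℝ x e = 0) (t : ℝ) :
    ‖rotate e t x‖ = 1 := by
  have hsq : ‖rotate e t x‖ ^ 2 = 1 := by
    rw [rotate, norm_add_sq_real, inner_smul_left, inner_smul_right, hxe, norm_smul, norm_smul,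
      he, hx]
    simp
  exact (pow_eq_one_iff_of_nonneg (norm_nonneg _) two_ne_zero).1 hsq

theorem norm_rotate_sub_rotate_le {e y : E} (he : ‖e‖ = 1) (hy : ‖y‖ = 1) (x : E) (s t : ℝ) :
    ‖rotate e s x - rotate e t y‖ ≤ ‖x - y‖ + 2 * |s - t| := by
  have hcos : |Real.cos s - Real.cos t| ≤ |s - t| := by
    simpa [Real.dist_eq] using Real.lipschitzWith_cos.dist_le_mul s t
  have hsin : |Real.sin s - Real.sin t| ≤ |s - t| := by
    simpa [Real.dist_eq] using Real.lipschitzWith_sin.dist_le_mul s t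
  calc ‖rotate e s x - rotate e t y‖
      = ‖Real.cos s • (x - y) + ((Real.cos s - Real.cos t) • y +
          (Real.sin s - Real.sin t) • e)‖ := by
        congr 1
        simp only [rotate]
        module
    _ ≤ |Real.cos s| * ‖x - y‖ + (|Real.cos s - Real.cos t| * ‖y‖ +
          |Real.sin s - Real.sin t| * ‖e‖) := by
        simp only [← Real.norm_eq_abs, ← norm_smul]
        exact (norm_add_le _ _).trans (by gcongr; exact norm_add_le _ _)
    _ ≤ 1 * ‖x - y‖ + (|s - t| * 1 + |s - t| * 1) := by
        rw [he, hy]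
        gcongr
        exact Real.abs_cos_le_one s
    _ = ‖x - y‖ + 2 * |s - t| := by ring

/-- The `k`-simplices with vertices on the unit sphere of the span of `e 0, …, e k` and with
diameter at most `k θ`. -/
def fineSimplices (e : ℕ → E) (θ : ℝ) (k : ℕ) : Set (List E) :=
  {l | l.length = k + 1 ∧ (∀ v ∈ l, ‖v‖ = 1 ∧ v ∈ Submodule.span ℝ (e '' Iic k)) ∧
    ∀ v ∈ l, ∀ w ∈ l, ‖v - w‖ ≤ k * θ}

/-- A triangulated hemisphere of the unit sphere of the span of `e 0, …, e k`: the equator, made of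
two opposite hemispheres of one dimension less, is rotated to the pole `e k` in `N` steps, and each
step sweeps out a prism. -/
def hemisphere (e : ℕ → E) (N : ℕ) : ℕ → ModTwoChain E
  | 0 => simplex [e 0]
  | k + 1 => ∑ j ∈ Finset.range N,
      prism (rotate (e (k + 1)) (j * (Real.pi / 2 / N)))
        (rotate (e (k + 1)) ((j + 1) * (Real.pi / 2 / N)))
        (hemisphere e N k + push Neg.neg (hemisphere e N k))

theorem push_neg_mem_fineSimplices {e : ℕ → E} {θ : ℝ} {k : ℕ} {c : ModTwoChain E}
    (hc : c ∈ supportedOn (fineSimplices e θ k)) :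
    push Neg.neg c ∈ supportedOn (fineSimplices e θ k) := by
  refine map_mem_of_mem_supportedOn ?_ hc
  rintro l ⟨hlen, hunit, hdiam⟩
  rw [push_simplex]
  refine simplex_mem_supportedOn ⟨by simpa using hlen, fun v hv => ?_, fun v hv w hw => ?_⟩
  · obtain ⟨x, hx, rfl⟩ := List.mem_map.1 hv
    rw [norm_neg, Submodule.neg_mem_iff]
    exact hunit x hx
  · obtain ⟨x, hx, rfl⟩ := List.mem_map.1 hv
    obtain ⟨y, hy, rfl⟩ := List.mem_map.1 hw
    rw [neg_sub_neg]
    exact hdiam y hy x hx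

theorem inner_succ_eq_zero_of_mem_span {e : ℕ → E} (he : Orthonormal ℝ e) {k : ℕ} {x : E}
    (hx : x ∈ Submodule.span ℝ (e '' Iic k)) : inner ℝ x (e (k + 1)) = 0 := by
  have hle : Submodule.span ℝ (e '' Iic k) ≤ (ℝ ∙ e (k + 1))ᗮ := by
    rw [Submodule.span_le]
    rintro _ ⟨j, hj, rfl⟩
    exact Submodule.mem_orthogonal_singleton_iff_inner_left.2
      (he.2 (Nat.lt_succ_of_le hj).ne)
  exact Submodule.mem_orthogonal_singleton_iff_inner_left.1 (hle hx)

theorem rotated_mem_fineSimplices {e : ℕ → E} (he : Orthonormal ℝ e) {k : ℕ} {a b : ℝ}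
    {l m : List E} (hl : l ∈ fineSimplices e (2 * |a - b|) k) (hlen : m.length = l.length + 1)
    (hm : ∀ v ∈ m, ∃ x ∈ l, v = rotate (e (k + 1)) a x ∨ v = rotate (e (k + 1)) b x) :
    m ∈ fineSimplices e (2 * |a - b|) (k + 1) := by
  obtain ⟨hlen', hunit, hdiam⟩ := hl
  have hangle : ∀ v ∈ m, ∃ x ∈ l, ∃ t, (t = a ∨ t = b) ∧ v = rotate (e (k + 1)) t x := by
    intro v hv
    obtain ⟨x, hx, rfl | rfl⟩ := hm v hv
    exacts [⟨x, hx, a, Or.inl rfl, rfl⟩, ⟨x, hx, b, Or.inr rfl, rfl⟩]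
  refine ⟨by omega, fun v hv => ?_, fun v hv w hw => ?_⟩
  · obtain ⟨x, hx, t, -, rfl⟩ := hangle v hv
    obtain ⟨hx1, hxspan⟩ := hunit x hx
    have hx' : x ∈ Submodule.span ℝ (e '' Iic (k + 1)) :=
      Submodule.span_mono (image_mono (Iic_subset_Iic.2 k.le_succ)) hxspan
    have he' : e (k + 1) ∈ Submodule.span ℝ (e '' Iic (k + 1)) :=
      Submodule.subset_span (mem_image_of_mem e self_mem_Iic)
    exact ⟨norm_rotate (he.1 _) hx1 (inner_succ_eq_zero_of_mem_span he hxspan) t,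
      Submodule.add_mem _ (Submodule.smul_mem _ _ hx') (Submodule.smul_mem _ _ he')⟩
  · obtain ⟨x, hx, s, hs, rfl⟩ := hangle v hv
    obtain ⟨y, hy, t, ht, rfl⟩ := hangle w hw
    have hst : |s - t| ≤ |a - b| := by
      rcases hs with rfl | rfl <;> rcases ht with rfl | rfl <;> simp [abs_sub_comm]
    have hrot := norm_rotate_sub_rotate_le (he.1 (k + 1)) (hunit y hy).1 x s t
    have hxy := hdiam x hx y hy
    push_cast
    linarith

theorem hemisphere_mem_fineSimplices {e : ℕ → E} (he : Orthonormal ℝ e) (N k : ℕ) :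
    hemisphere e N k ∈ supportedOn (fineSimplices e (Real.pi / N) k) := by
  induction k with
  | zero =>
    refine simplex_mem_supportedOn ⟨rfl, ?_, by simp⟩
    simpa [he.1 0] using Submodule.subset_span (mem_image_of_mem e (self_mem_Iic (a := 0)))
  | succ k ih =>
    refine Submodule.sum_mem _ fun j _ => map_mem_of_mem_supportedOn (fun l hl => ?_)
      (Submodule.add_mem _ ih (push_neg_mem_fineSimplices ih))
    have hstep : Real.pi / N =
        2 * |j * (Real.pi / 2 / N) - (j + 1) * (Real.pi / 2 / N)| := by
      rw [← sub_mul, abs_mul, abs_of_nonneg (by positivity : 0 ≤ Real.pi / 2 / N)]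
      simp only [sub_add_cancel_left, abs_neg, abs_one]
      ring
    rw [hstep] at hl ⊢
    exact Finsupp.supported_mono (fun m hm => rotated_mem_fineSimplices he hl hm.1 hm.2)
      (prism_simplex_mem_supportedOn _ _ l)

theorem boundary_hemisphere_succ_of_cycle {e : ℕ → E} {N : ℕ} (hN : N ≠ 0) {k : ℕ}
    (hz : boundary (hemisphere e N k + push Neg.neg (hemisphere e N k)) = 0) :
    boundary (hemisphere e N (k + 1)) = hemisphere e N k + push Neg.neg (hemisphere e N k) := by
  have hsweep := boundary_sum_prism (fun j : ℕ => rotate (e (k + 1)) (j * (Real.pi / 2 / N))) hz N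
  have hstart : ∀ x, rotate (e (k + 1)) (((0 : ℕ) : ℝ) * (Real.pi / 2 / N)) x = x := by
    simp [rotate]
  have hend : rotate (e (k + 1)) (N * (Real.pi / 2 / N)) = fun _ => e (k + 1) := by
    funext x
    simp [rotate, mul_div_cancel₀ (Real.pi / 2) (Nat.cast_ne_zero.2 hN : (N : ℝ) ≠ 0)]
  -- At the pole the two opposite hemispheres have the same image, so they cancel.
  have hpole : push (fun _ => e (k + 1)) (hemisphere e N k) +
      push (fun _ => e (k + 1)) (push Neg.neg (hemisphere e N k)) = 0 := by
    rw [push_push]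
    exact ZModModule.add_self _
  simp only [hend, push_eq_self hstart, map_add, hpole, add_zero] at hsweep
  simpa only [hemisphere, Nat.cast_add, Nat.cast_one, map_add] using hsweep

theorem boundary_hemisphere_succ (e : ℕ → E) {N : ℕ} (hN : N ≠ 0) (k : ℕ) :
    boundary (hemisphere e N (k + 1)) = hemisphere e N k + push Neg.neg (hemisphere e N k) := by
  refine boundary_hemisphere_succ_of_cycle hN ?_
  induction k with
  | zero =>
    simp [hemisphere, boundary, simplexBoundary, ZModModule.add_self]
  | succ k ih =>
    rw [map_add, boundary_push, boundary_hemisphere_succ_of_cycle hN ih, map_add, push_push,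
      push_eq_self (h := Neg.neg ∘ Neg.neg) neg_neg, add_comm (push Neg.neg _),
      ZModModule.add_self]

theorem extend_cup_hemisphere {e : ℕ → E} (he : Orthonormal ℝ e) {N : ℕ} (hN : N ≠ 0)
    {β : ℕ → E → ZMod 2} (hβ : ∀ k x, ‖x‖ = 1 → β k (-x) = β k x + 1) (k : ℕ) :
    extend (cup β k) (hemisphere e N k) = 1 := by
  induction k with
  | zero => simp [hemisphere, cup]
  | succ k ih =>
    calc extend (cup β (k + 1)) (hemisphere e N (k + 1))
        = extend (cupPrimitive β k) (boundary (hemisphere e N (k + 1))) :=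
          map_eq_of_mem_supportedOn (g := extend (cupPrimitive β k) ∘ₗ boundary)
            (fun l hl => by simp [extend_cupPrimitive_boundary β k l hl.1])
            (hemisphere_mem_fineSimplices he N (k + 1))
      _ = extend (cupPrimitive β k) (hemisphere e N k + push Neg.neg (hemisphere e N k)) := by
          rw [boundary_hemisphere_succ e hN]
      _ = extend (cup β k) (hemisphere e N k) := by
          refine map_eq_of_mem_supportedOn
            (f := extend (cupPrimitive β k) ∘ₗ (LinearMap.id + push Neg.neg)) ?_
            (hemisphere_mem_fineSimplices he N k)
          rintro (_ | ⟨v, l⟩) ⟨hlen, hunit, -⟩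
          · simp at hlen
          have hcup := cup_map_of_odd k (v :: l) fun i x hx => hβ i x (hunit x hx).1
          have hodd : ∀ a b : ZMod 2, a * b + (a + 1) * b = b := by decide
          simp only [List.map_cons] at hcup
          simp [cupPrimitive, hcup, hβ k v (hunit v (by simp)).1, hodd]
      _ = 1 := ih

theorem exists_fineSimplex_forall_not_const {e : ℕ → E} (he : Orthonormal ℝ e) {N : ℕ} (hN : N ≠ 0)
    {β : ℕ → E → ZMod 2} (hβ : ∀ k x, ‖x‖ = 1 → β k (-x) = β k x + 1) (m : ℕ) :
    ∃ l ∈ fineSimplices e (Real.pi / N) m, ∀ i < m, ∀ b, ∃ v ∈ l, β i v ≠ b := by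
  by_contra! hconst
  have hzero : extend (cup β m) (hemisphere e N m) = 0 := by
    refine map_eq_of_mem_supportedOn (g := 0) (fun l hl => ?_)
      (hemisphere_mem_fineSimplices he N m)
    obtain ⟨i, hi, b, hb⟩ := hconst l hl
    rw [extend_simplex, cup_eq_zero_of_forall_eq hi l hb, LinearMap.zero_apply]
  exact one_ne_zero ((extend_cup_hemisphere he hN hβ m).symm.trans hzero)

end ModTwoChain

theorem neg_notMem_thickening {E : Type*} [SeminormedAddCommGroup E] {C : Set E} {ε : ℝ}
    (hsep : ∀ x ∈ C, ∀ y ∈ C, ε ≤ ‖x + y‖) {x : E} (hx : x ∈ Metric.thickening (ε / 2) C) :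
    -x ∉ Metric.thickening (ε / 2) C := by
  intro hx'
  obtain ⟨y, hy, hxy⟩ := Metric.mem_thickening_iff.1 hx
  obtain ⟨z, hz, hxz⟩ := Metric.mem_thickening_iff.1 hx'
  rw [dist_eq_norm, norm_sub_rev] at hxy hxz
  have hle : ‖y + z‖ ≤ ‖y - x‖ + ‖z - -x‖ :=
    (congrArg norm (by abel)).le.trans (norm_add_le (y - x) (z - -x))
  linarith [hsep y hy z hz]

open ModTwoChain in
theorem lusternik_schnirelmann {E : Type*} [NormedAddCommGroup E] [InnerProductSpace ℝ E]
    {e : ℕ → E} (he : Orthonormal ℝ e) {m : ℕ} (C : Fin m → Set E) {ε : ℝ} (hε : 0 < ε)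
    (hsep : ∀ i, ∀ x ∈ C i, ∀ y ∈ C i, ε ≤ ‖x + y‖) :
    ∃ x ∈ Submodule.span ℝ (e '' Iic m), ‖x‖ = 1 ∧ ∀ i, x ∉ C i ∧ -x ∉ C i := by
  let U : ℕ → Set E := fun k => ⋃ h : k < m, Metric.thickening (ε / 2) (C ⟨k, h⟩)
  have hU : ∀ k, ∀ x ∈ U k, -x ∉ U k := by
    intro k x hx hx'
    obtain ⟨h, hx⟩ := mem_iUnion.1 hx
    obtain ⟨_, hx'⟩ := mem_iUnion.1 hx'
    exact neg_notMem_thickening (hsep _) hx hx'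
  choose P hUP hP using fun k => exists_antipodal_half (hU k)
  let β : ℕ → E → ZMod 2 := fun k => (P k).indicator 1
  have hβ : ∀ k x, ‖x‖ = 1 → β k (-x) = β k x + 1 := by
    intro k x hx
    have := IsAddTorsionFree.of_isTorsionFree ℝ E
    have hne : -x ≠ x := fun h => by simp [self_eq_neg.1 h.symm] at hx
    by_cases hxP : x ∈ P k
    · simpa [β, hxP, hP k x hne] using (CharTwo.add_self_eq_zero (1 : ZMod 2)).symm
    · simp [β, hxP, hP k x hne]
  obtain ⟨N, hN⟩ := exists_nat_gt (m * Real.pi / (ε / 2))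
  have hN0 : (0 : ℝ) < N := lt_of_le_of_lt (by positivity) hN
  have hmesh : m * (Real.pi / N) < ε / 2 := by
    rwa [← mul_div_assoc, div_lt_comm₀ hN0 (by positivity)]
  obtain ⟨l, ⟨hlen, hunit, hdiam⟩, hl⟩ :=
    exists_fineSimplex_forall_not_const he (Nat.cast_pos.1 hN0).ne' hβ m
  obtain ⟨v, hv⟩ := List.exists_mem_of_length_pos (l := l) (by omega)
  refine ⟨v, (hunit v hv).2, (hunit v hv).1, fun i => ⟨fun hvC => ?_, fun hvC => ?_⟩⟩
  · obtain ⟨w, hw, hβw⟩ := hl i i.2 1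
    have hwU : w ∈ U i := mem_iUnion.2 ⟨i.2, Metric.mem_thickening_iff.2
      ⟨v, hvC, (dist_eq_norm w v).trans_lt ((hdiam w hw v hv).trans_lt hmesh)⟩⟩
    exact hβw (indicator_of_mem (hUP i hwU) 1)
  · obtain ⟨w, hw, hβw⟩ := hl i i.2 0
    have hwU : -w ∈ U i := mem_iUnion.2 ⟨i.2, Metric.mem_thickening_iff.2
      ⟨-v, hvC, by rw [dist_neg_neg, dist_eq_norm]; exact (hdiam w hw v hv).trans_lt hmesh⟩⟩
    have hodd := hβ i w (hunit w hw).1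
    rw [show β i (-w) = 1 from indicator_of_mem (hUP i hwU) 1, right_eq_add] at hodd
    exact hβw hodd

/-! ### Genus and odd descent -/

open Filter Topology

/-- `A` is covered up to sign by `n` compact sets containing no antipodal pair, that is, its
Krasnoselskii genus is at most `n`. -/
def GenusLE {X : Type*} [TopologicalSpace X] [Neg X] (A : Set X) (n : ℕ) : Prop :=
  ∃ C : Fin n → Set X, (∀ i, IsCompact (C i) ∧ ∀ x ∈ C i, -x ∉ C i) ∧
    ∀ x ∈ A, ∃ i, x ∈ C i ∨ -x ∈ C i

namespace GenusLE

theorem empty {X : Type*} [TopologicalSpace X] [Neg X] (n : ℕ) : GenusLE (∅ : Set X) n :=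
  ⟨fun _ => ∅, by simp, by simp⟩

theorem comap {X Y : Type*} [TopologicalSpace X] [Neg X] [TopologicalSpace Y] [T2Space Y]
    [Neg Y] {φ : X → Y} (hφ : Continuous φ) (hodd : ∀ x, φ (-x) = -φ x) {A : Set X}
    (hA : IsCompact A) (hneg : ∀ x ∈ A, -x ∈ A) {n : ℕ} (h : GenusLE (φ '' A) n) :
    GenusLE A n := by
  obtain ⟨C, hC, hcov⟩ := h
  refine ⟨fun i => A ∩ φ ⁻¹' C i, fun i => ⟨hA.inter_right ((hC i).1.isClosed.preimage hφ),
    fun x hx hx' => (hC i).2 (φ x) hx.2 (hodd x ▸ hx'.2)⟩, fun x hx => ?_⟩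
  obtain ⟨i, h | h⟩ := hcov (φ x) (mem_image_of_mem _ hx)
  · exact ⟨i, Or.inl ⟨hx, h⟩⟩
  · exact ⟨i, Or.inr ⟨hneg x hx, by rwa [mem_preimage, hodd]⟩⟩

theorem succ_of_diff {X : Type*} [TopologicalSpace X] [Neg X] {A U Q : Set X} {n : ℕ}
    (h : GenusLE (A \ U) n) (hQ : IsCompact Q) (hfree : ∀ x ∈ Q, -x ∉ Q)
    (hcov : ∀ x ∈ A ∩ U, x ∈ Q ∨ -x ∈ Q) : GenusLE A (n + 1) := by
  obtain ⟨C, hC, hcovC⟩ := h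
  refine ⟨Fin.cons Q C, Fin.forall_fin_succ.2 ⟨⟨hQ, hfree⟩, hC⟩,
    fun x hx => Fin.exists_fin_succ.2 ?_⟩
  by_cases hxU : x ∈ U
  exacts [Or.inl (hcov x ⟨hx, hxU⟩), Or.inr (hcovC x ⟨hx, hxU⟩)]

end GenusLE

theorem exists_compact_antipodal_half_near {X : Type*} [PseudoMetricSpace X] [InvolutiveNeg X]
    (hdist : ∀ x y : X, dist (-x) (-y) = dist x y) {B K : Set X} (hB : IsCompact B)
    (hBneg : ∀ x ∈ B, -x ∈ B) (hKneg : ∀ y ∈ K, -y ∈ K) (hfree : ∀ y ∈ K, -y ≠ y) {κ : ℝ}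
    (hκ : 0 < κ) (hsep : ∀ x ∈ K, ∀ y ∈ K, x ≠ y → κ ≤ dist x y) :
    ∃ Q, IsCompact Q ∧ (∀ x ∈ Q, -x ∉ Q) ∧
      ∀ x ∈ B ∩ Metric.thickening (κ / 4) K, x ∈ Q ∨ -x ∈ Q := by
  obtain ⟨P, -, hP⟩ := exists_antipodal_half (U := (∅ : Set X)) (by simp)
  refine ⟨B ∩ Metric.cthickening (κ / 4) (K ∩ P), hB.inter_right Metric.isClosed_cthickening,
    fun x hx hx' => ?_, fun x ⟨hxB, hxK⟩ => ?_⟩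
  · have hsub := Metric.cthickening_subset_thickening' (δ₁ := κ / 4) (δ₂ := κ / 2)
      (by positivity) (by linarith) (K ∩ P)
    obtain ⟨y, ⟨hyK, hyP⟩, hxy⟩ := Metric.mem_thickening_iff.1 (hsub hx.2)
    obtain ⟨z, ⟨hzK, hzP⟩, hxz⟩ := Metric.mem_thickening_iff.1 (hsub hx'.2)
    rw [← hdist, neg_neg] at hxz
    have hyz : y ≠ -z := fun h => (hP z (hfree z hzK)).1 (h ▸ hyP) hzP
    linarith [hsep y hyK (-z) (hKneg z hzK) hyz, dist_triangle_left y (-z) x]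
  · obtain ⟨y, hyK, hxy⟩ := Metric.mem_thickening_iff.1 hxK
    have hsub := Metric.thickening_subset_cthickening (κ / 4) (K ∩ P)
    by_cases hyP : y ∈ P
    · exact Or.inl ⟨hxB, hsub (Metric.mem_thickening_iff.2 ⟨y, ⟨hyK, hyP⟩, hxy⟩)⟩
    · exact Or.inr ⟨hBneg x hxB, hsub (Metric.mem_thickening_iff.2
        ⟨-y, ⟨hKneg y hyK, (hP y (hfree y hyK)).2 hyP⟩, by rwa [hdist]⟩)⟩

theorem exists_pos_forall_of_finite {ι : Type*} {s : Set ι} (hs : s.Finite) {P : ℝ → ι → Prop}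
    (hanti : ∀ i, Antitone fun κ => P κ i) (hpos : ∀ i ∈ s, ∃ κ, 0 < κ ∧ P κ i) :
    ∃ κ, 0 < κ ∧ ∀ i ∈ s, P κ i := by
  have hsmall : ∀ i ∈ s, ∀ᶠ κ in 𝓝[>] (0 : ℝ), P κ i := by
    intro i hi
    obtain ⟨κ, hκ, hP⟩ := hpos i hi
    filter_upwards [Ioo_mem_nhdsGT hκ] with κ' hκ'
    exact hanti i hκ'.2.le hP
  obtain ⟨κ, hP, hκ⟩ := (((eventually_all_finite hs).2 hsmall).and self_mem_nhdsWithin).exists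
  exact ⟨κ, hκ, hP⟩

section Genus

variable {E : Type*} [NormedAddCommGroup E]

theorem exists_pos_le_norm_add {C : Set (Metric.sphere (0 : E) 1)} (hC : IsCompact C)
    (hfree : ∀ x ∈ C, -x ∉ C) : ∃ ε, 0 < ε ∧ ∀ x ∈ C, ∀ y ∈ C, ε ≤ ‖(x + y : E)‖ := by
  obtain ⟨ε, hε, hle⟩ := (hC.prod hC).exists_forall_le' (a := 0)
    (f := fun q => ‖(q.1 + q.2 : E)‖) (by fun_prop) fun q hq => norm_pos_iff.2 fun hsum =>
      hfree q.1 hq.1 <| by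
        rw [show -q.1 = q.2 from Subtype.ext (neg_eq_of_add_eq_zero_right hsum)]
        exact hq.2
  exact ⟨ε, hε, fun x hx y hy => hle (x, y) ⟨hx, hy⟩⟩

variable [InnerProductSpace ℝ E]

theorem not_genusLE_sphere {e : ℕ → E} (he : Orthonormal ℝ e) (m : ℕ) :
    ¬ GenusLE {v : Metric.sphere (0 : E) 1 | (v : E) ∈ Submodule.span ℝ (e '' Iic m)} m := by
  rintro ⟨C, hC, hcov⟩
  obtain ⟨ε, hε, hsep⟩ := exists_pos_forall_of_finite finite_univ
    (P := fun ε i => ∀ x ∈ C i, ∀ y ∈ C i, ε ≤ ‖(x + y : E)‖)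
    (fun i κ κ' hle h x hx y hy => hle.trans (h x hx y hy))
    fun i _ => exists_pos_le_norm_add (hC i).1 (hC i).2
  obtain ⟨x, hx, hx_norm, hx_notMem⟩ := lusternik_schnirelmann he (fun i => (↑) '' C i) hε <| by
    rintro i _ ⟨x, hx, rfl⟩ _ ⟨y, hy, rfl⟩
    exact hsep i (mem_univ i) x hx y hy
  obtain ⟨i, hi | hi⟩ := hcov ⟨x, mem_sphere_zero_iff_norm.2 hx_norm⟩ hx
  · exact (hx_notMem i).1 ⟨_, hi, rfl⟩
  · exact (hx_notMem i).2 ⟨_, hi, rfl⟩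

theorem isCompact_sphere_submodule (W : Submodule ℝ E) [FiniteDimensional ℝ W] :
    IsCompact {v : Metric.sphere (0 : E) 1 | (v : E) ∈ W} := by
  rw [Topology.IsEmbedding.subtypeVal.isCompact_iff]
  convert (isCompact_sphere (0 : W) 1).image continuous_subtype_val using 1
  ext x
  constructor
  · rintro ⟨v, hv, rfl⟩
    exact ⟨⟨v, hv⟩, by simp, rfl⟩
  · rintro ⟨w, hw, rfl⟩
    exact ⟨⟨w, by simpa using hw⟩, w.2, rfl⟩

end Genus

/-- An odd self-map of a metric space that decreases an even continuous function, and whose nearly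
stationary points form well separated clusters on every sublevel set. -/
structure DescentSystem (X : Type*) [MetricSpace X] [InvolutiveNeg X] where
  /-- one step of the descent -/
  map : X → X
  /-- the quantity that descends -/
  energy : X → ℝ
  /-- the energy lost per squared distance travelled -/
  rate : ℝ
  dist_neg : ∀ x y : X, dist (-x) (-y) = dist x y
  continuous_map : Continuous map
  continuous_energy : Continuous energy
  map_neg : ∀ x, map (-x) = -map x
  energy_neg : ∀ x, energy (-x) = energy x
  energy_nonneg : ∀ x, 0 ≤ energy x
  rate_pos : 0 < rate
  descent : ∀ x, rate * dist (map x) x ^ 2 ≤ energy x - energy (map x)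
  clusters : ∀ D : ℝ, ∃ κ : ℝ, 0 < κ ∧ ∀ ε : ℝ, 0 < ε → ∃ δ : ℝ, 0 < δ ∧ ∀ x y,
    energy x ≤ D → energy y ≤ D → energy x - energy (map x) ≤ δ → energy y - energy (map y) ≤ δ →
      dist x y < ε ∨ κ ≤ dist x y

namespace DescentSystem

variable {X : Type*} [MetricSpace X] [InvolutiveNeg X] (S : DescentSystem X)

theorem antitone_energy (x : X) : Antitone fun n => S.energy (S.map^[n] x) := by
  refine antitone_nat_of_succ_le fun n => ?_
  rw [Function.iterate_succ_apply']
  have hdescent := S.descent (S.map^[n] x)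
  have hnonneg := mul_nonneg S.rate_pos.le (sq_nonneg (dist (S.map (S.map^[n] x)) (S.map^[n] x)))
  linarith

theorem energy_iterate_le (x : X) (n : ℕ) : S.energy (S.map^[n] x) ≤ S.energy x :=
  S.antitone_energy x n.zero_le

theorem iterate_neg (x : X) (n : ℕ) : S.map^[n] (-x) = -S.map^[n] x :=
  ((show Function.Commute S.map Neg.neg from S.map_neg).iterate_left n x)

theorem continuous_iterate (n : ℕ) : Continuous (S.map^[n]) := S.continuous_map.iterate n

theorem dist_iterate_succ_lt {x : X} {ρ : ℝ} (hρ : 0 ≤ ρ) {n : ℕ}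
    (h : S.energy x - S.energy (S.map^[n + 1] x) < S.rate * ρ ^ 2) :
    dist (S.map^[n + 1] x) (S.map^[n] x) < ρ := by
  have hdescent := S.descent (S.map^[n] x)
  rw [← Function.iterate_succ_apply' S.map] at hdescent
  have hlt : S.rate * dist (S.map^[n + 1] x) (S.map^[n] x) ^ 2 < S.rate * ρ ^ 2 := by
    linarith [S.energy_iterate_le x n]
  exact lt_of_pow_lt_pow_left₀ 2 hρ (lt_of_mul_lt_mul_left hlt S.rate_pos.le)

theorem exists_dist_iterate_lt (D : ℝ) {r : ℝ} (hr : 0 < r) : ∃ ε : ℝ, 0 < ε ∧ ∀ x,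
    S.energy x ≤ D → ∀ n, S.energy x - S.energy (S.map^[n] x) < ε → dist (S.map^[n] x) x < r := by
  obtain ⟨κ, hκ, hcl⟩ := S.clusters D
  set ρ := min (r / 2) (κ / 2)
  have hρ : 0 < ρ := by positivity
  have hρr : 2 * ρ ≤ r := by linarith [min_le_left (r / 2) (κ / 2)]
  have hρκ : 2 * ρ ≤ κ := by linarith [min_le_right (r / 2) (κ / 2)]
  obtain ⟨δ, hδ, hcl⟩ := hcl ρ hρ
  have hrate := S.rate_pos
  refine ⟨min δ (S.rate * ρ ^ 2), by positivity, fun x hx => ?_⟩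
  have hstep : ∀ n, S.energy x - S.energy (S.map^[n + 1] x) < min δ (S.rate * ρ ^ 2) →
      dist (S.map^[n + 1] x) (S.map^[n] x) < ρ :=
    fun n hn => S.dist_iterate_succ_lt hρ.le (hn.trans_le (min_le_right _ _))
  have hslow : ∀ n, S.energy x - S.energy (S.map^[n + 1] x) < min δ (S.rate * ρ ^ 2) →
      S.energy (S.map^[n] x) - S.energy (S.map (S.map^[n] x)) ≤ δ := by
    intro n hn
    rw [← Function.iterate_succ_apply' S.map]
    linarith [min_le_left δ (S.rate * ρ ^ 2), S.energy_iterate_le x n]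
  -- Slow steps are shorter than the gap between clusters, so the trajectory stays in its cluster.
  have hcluster : ∀ n, S.energy x - S.energy (S.map^[n + 1] x) < min δ (S.rate * ρ ^ 2) →
      dist (S.map^[n] x) x < ρ := by
    intro n hn
    induction n with
    | zero => simpa using hρ
    | succ n ih =>
      have hn' := (sub_le_sub_left (S.antitone_energy x (n + 1).le_succ) _).trans_lt hn
      have hzero := (sub_le_sub_left (S.antitone_energy x (show 0 + 1 ≤ n + 1 + 1 by omega))
        _).trans_lt hn
      refine (hcl _ x ((S.energy_iterate_le x _).trans hx) hx (hslow _ hn)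
        (hslow 0 hzero)).resolve_right fun hfar => ?_
      linarith [dist_triangle (S.map^[n + 1] x) (S.map^[n] x) x, ih hn', hstep n hn']
  rintro (_ | n) hn
  · simpa using hr
  · linarith [dist_triangle (S.map^[n + 1] x) (S.map^[n] x) x, hcluster n hn, hstep n hn]

theorem exists_tendsto_iterate [CompleteSpace X] (x : X) :
    ∃ y, S.map y = y ∧ Tendsto (fun n => S.map^[n] x) atTop (𝓝 y) ∧
      Tendsto (fun n => S.energy (S.map^[n] x)) atTop (𝓝 (S.energy y)) ∧
      S.energy y ≤ S.energy x := by
  have hbdd : BddBelow (range fun n => S.energy (S.map^[n] x)) :=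
    ⟨0, by rintro _ ⟨n, rfl⟩; exact S.energy_nonneg _⟩
  have hlim := tendsto_atTop_ciInf (S.antitone_energy x) hbdd
  have hge := fun n => ciInf_le hbdd n
  set ℓ := ⨅ n, S.energy (S.map^[n] x)
  have hcauchy : CauchySeq fun n => S.map^[n] x := by
    rw [Metric.cauchySeq_iff']
    intro r hr
    obtain ⟨ε, hε, hclose⟩ := S.exists_dist_iterate_lt (S.energy x) hr
    obtain ⟨N, hN⟩ := (hlim.eventually (gt_mem_nhds (lt_add_of_pos_right ℓ hε))).exists
    refine ⟨N, fun n hn => ?_⟩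
    obtain ⟨k, rfl⟩ := Nat.exists_eq_add_of_le' hn
    rw [Function.iterate_add_apply]
    refine hclose _ (S.energy_iterate_le x N) k ?_
    rw [← Function.iterate_add_apply]
    linarith [hge (k + N)]
  obtain ⟨y, hy⟩ := cauchySeq_tendsto_of_complete hcauchy
  have hE : Tendsto (fun n => S.energy (S.map^[n] x)) atTop (𝓝 (S.energy y)) :=
    (S.continuous_energy.tendsto y).comp hy
  exact ⟨y, isFixedPt_of_tendsto_iterate hy S.continuous_map.continuousAt, hy, hE,
    le_of_tendsto' hE (S.energy_iterate_le x)⟩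

theorem exists_fixed_separated (D : ℝ) : ∃ κ : ℝ, 0 < κ ∧ ∀ x y, S.map x = x → S.map y = y →
    S.energy x ≤ D → S.energy y ≤ D → x ≠ y → κ ≤ dist x y := by
  obtain ⟨κ, hκ, hcl⟩ := S.clusters D
  refine ⟨κ, hκ, fun x y hx hy hxD hyD hne => ?_⟩
  obtain ⟨δ, hδ, h⟩ := hcl (dist x y) (dist_pos.2 hne)
  exact (h x y hxD hyD (by rw [hx, sub_self]; exact hδ.le)
    (by rw [hy, sub_self]; exact hδ.le)).resolve_left (lt_irrefl _)

theorem exists_eventually_energy_lt {x y : X} {c : ℝ}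
    (hE : Tendsto (fun n => S.energy (S.map^[n] x)) atTop (𝓝 (S.energy y)))
    (hy : S.energy y < c) : ∃ n, ∀ᶠ z in 𝓝 x, ∀ m ≥ n, S.energy (S.map^[m] z) < c := by
  obtain ⟨n, hn⟩ := (hE.eventually (gt_mem_nhds hy)).exists
  have hopen := isOpen_lt (S.continuous_energy.comp (S.continuous_iterate n))
    (continuous_const (y := c))
  refine ⟨n, ?_⟩
  filter_upwards [hopen.mem_nhds hn] with z hz m hm using (S.antitone_energy z hm).trans_lt hz

theorem exists_eventually_dist_lt {x y : X}
    (hlim : Tendsto (fun n => S.map^[n] x) atTop (𝓝 y))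
    (hE : Tendsto (fun n => S.energy (S.map^[n] x)) atTop (𝓝 (S.energy y)))
    {r : ℝ} (hr : 0 < r) : ∃ n, ∀ᶠ z in 𝓝 x, ∀ m ≥ n,
      S.energy (S.map^[m] z) < S.energy y ∨ dist (S.map^[m] z) y < r := by
  obtain ⟨ε, hε, hclose⟩ := S.exists_dist_iterate_lt (S.energy y + 1) (half_pos hr)
  have hε' : 0 < min ε 1 := by positivity
  obtain ⟨n, hnE, hnd⟩ := ((hE.eventually (gt_mem_nhds (lt_add_of_pos_right _ hε'))).and
    (hlim.eventually (Metric.ball_mem_nhds y (half_pos hr)))).exists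
  have hopen := (isOpen_lt (S.continuous_energy.comp (S.continuous_iterate n))
    (continuous_const (y := S.energy y + min ε 1))).inter
    (isOpen_lt ((S.continuous_iterate n).dist (continuous_const (y := y)))
      (continuous_const (y := r / 2)))
  refine ⟨n, ?_⟩
  filter_upwards [hopen.mem_nhds ⟨hnE, hnd⟩] with z hz m hm
  obtain ⟨k, rfl⟩ := Nat.exists_eq_add_of_le' hm
  obtain ⟨hzE : S.energy (S.map^[n] z) < S.energy y + min ε 1, hzd : dist (S.map^[n] z) y < r / 2⟩
    := hz
  rw [Function.iterate_add_apply]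
  refine or_iff_not_imp_left.2 fun hlow => ?_
  have hstay := hclose (S.map^[n] z) (by linarith [min_le_right ε 1]) k
    (by linarith [min_le_left ε 1])
  linarith [dist_triangle (S.map^[k] (S.map^[n] z)) (S.map^[n] z) y]

theorem exists_iterate_mem [CompleteSpace X] {A : Set X} (hA : IsCompact A) {c r : ℝ} (hr : 0 < r)
    (hc : ∀ y, S.map y = y → (∃ x ∈ A, S.energy y ≤ S.energy x) → S.energy y ≤ c) :
    ∃ n, ∀ x ∈ A, S.energy (S.map^[n] x) < c ∨
      ∃ y, S.map y = y ∧ S.energy y = c ∧ dist (S.map^[n] x) y < r := by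
  let good (m : ℕ) (z : X) : Prop := S.energy (S.map^[m] z) < c ∨
    ∃ y, S.map y = y ∧ S.energy y = c ∧ dist (S.map^[m] z) y < r
  have hlocal : ∀ x ∈ A, ∃ n, ∀ᶠ z in 𝓝 x, ∀ m ≥ n, good m z := by
    intro x hx
    obtain ⟨y, hy, hlim, hE, hyx⟩ := S.exists_tendsto_iterate x
    rcases (hc y hy ⟨x, hx, hyx⟩).lt_or_eq with hlt | rfl
    · obtain ⟨n, hn⟩ := S.exists_eventually_energy_lt hE hlt
      exact ⟨n, hn.mono fun z hz m hm => Or.inl (hz m hm)⟩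
    · obtain ⟨n, hn⟩ := S.exists_eventually_dist_lt hlim hE hr
      exact ⟨n, hn.mono fun z hz m hm => (hz m hm).imp_right fun h => ⟨y, hy, rfl, h⟩⟩
  obtain ⟨n, hn⟩ : ∃ n, ∀ x ∈ A, ∀ m ≥ n, good m x := by
    refine hA.induction_on (p := fun s => ∃ n, ∀ x ∈ s, ∀ m ≥ n, good m x) ⟨0, by simp⟩ ?_ ?_ ?_
    · rintro s t hst ⟨n, hn⟩
      exact ⟨n, fun x hx => hn x (hst hx)⟩
    · rintro s t ⟨n, hn⟩ ⟨k, hk⟩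
      exact ⟨max n k, fun x hx m hm => hx.elim (fun hx => hn x hx m (le_of_max_le_left hm))
        fun hx => hk x hx m (le_of_max_le_right hm)⟩
    · intro x hx
      obtain ⟨n, hn⟩ := hlocal x hx
      exact ⟨_, mem_nhdsWithin_of_mem_nhds hn, n, fun z hz => hz⟩
  exact ⟨n, fun x hx => hn x hx n le_rfl⟩

/-- Flow `A` down until it lies below the top critical level `c`, except near the fixed points at
that level; these are isolated, so one antipode-free set covers their neighbourhoods up to sign. -/
theorem exists_symmetric_below [CompleteSpace X] (hfree : ∀ x : X, -x ≠ x) {A : Set X}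
    (hA : IsCompact A) (hneg : ∀ x ∈ A, -x ∈ A) {c : ℝ}
    (hc : ∀ y, S.map y = y → (∃ x ∈ A, S.energy y ≤ S.energy x) → S.energy y ≤ c) :
    ∃ B : Set X, IsCompact B ∧ (∀ x ∈ B, -x ∈ B) ∧
      (∀ x ∈ B, S.energy x < c ∧ ∃ a ∈ A, S.energy x ≤ S.energy a) ∧
      ∀ n, GenusLE B n → GenusLE A (n + 1) := by
  obtain ⟨κ, hκ, hsep⟩ := S.exists_fixed_separated c
  obtain ⟨N, hN⟩ := S.exists_iterate_mem hA (r := κ / 4) (by positivity) hc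
  set K : Set X := {y | S.map y = y ∧ S.energy y = c}
  have hKneg : ∀ y ∈ K, -y ∈ K := fun y hy => ⟨by rw [S.map_neg, hy.1], by rw [S.energy_neg, hy.2]⟩
  have hBc : IsCompact (S.map^[N] '' A) := hA.image (S.continuous_iterate N)
  have hBneg : ∀ x ∈ S.map^[N] '' A, -x ∈ S.map^[N] '' A := by
    rintro _ ⟨x, hx, rfl⟩
    exact ⟨-x, hneg x hx, S.iterate_neg x N⟩
  obtain ⟨Q, hQ, hQfree, hQcov⟩ := exists_compact_antipodal_half_near S.dist_neg hBc hBneg hKneg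
    (fun y _ => hfree y) hκ fun x hx y hy => hsep x y hx.1 hy.1 hx.2.le hy.2.le
  refine ⟨S.map^[N] '' A \ Metric.thickening (κ / 4) K, hBc.diff Metric.isOpen_thickening,
    fun x hx => ⟨hBneg x hx.1, fun hxK => hx.2 ?_⟩, ?_, fun n hn =>
      (hn.succ_of_diff hQ hQfree hQcov).comap (S.continuous_iterate N) (S.iterate_neg · N) hA hneg⟩
  · obtain ⟨y, hy, hxy⟩ := Metric.mem_thickening_iff.1 hxK
    exact Metric.mem_thickening_iff.2 ⟨-y, hKneg y hy, by rwa [← S.dist_neg, neg_neg]⟩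
  · rintro _ ⟨⟨x, hx, rfl⟩, hxK⟩
    refine ⟨(hN x hx).resolve_right ?_, x, hx, S.energy_iterate_le x N⟩
    rintro ⟨y, hy, hyc, hxy⟩
    exact hxK (Metric.mem_thickening_iff.2 ⟨y, ⟨hy, hyc⟩, hxy⟩)

open Classical in
theorem genusLE [CompleteSpace X] (hfree : ∀ x : X, -x ≠ x) {V : Finset ℝ}
    (hV : ∀ y, S.map y = y → S.energy y ∈ V) {n : ℕ} {A : Set X} (hA : IsCompact A)
    (hneg : ∀ x ∈ A, -x ∈ A) (hcard : (V.filter fun c => ∃ x ∈ A, c ≤ S.energy x).card ≤ n) :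
    GenusLE A n := by
  induction n generalizing A with
  | zero =>
    obtain rfl : A = ∅ := eq_empty_of_forall_notMem fun x hx => by
      obtain ⟨y, hy, -, -, hyx⟩ := S.exists_tendsto_iterate x
      have hmem : S.energy y ∈ V.filter fun c => ∃ x ∈ A, c ≤ S.energy x :=
        Finset.mem_filter.2 ⟨hV y hy, x, hx, hyx⟩
      exact (Finset.card_pos.2 ⟨_, hmem⟩).not_ge hcard
    exact GenusLE.empty 0
  | succ n ih =>
    rcases A.eq_empty_or_nonempty with rfl | ⟨x, hx⟩
    · exact GenusLE.empty _
    obtain ⟨y, hy, -, -, hyx⟩ := S.exists_tendsto_iterate x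
    set W := V.filter fun c => ∃ x ∈ A, c ≤ S.energy x
    have hW : W.Nonempty := ⟨_, Finset.mem_filter.2 ⟨hV y hy, x, hx, hyx⟩⟩
    obtain ⟨B, hB, hBneg, hBlow, hBA⟩ := S.exists_symmetric_below hfree hA hneg
      (c := W.max' hW) fun y hy hyA => W.le_max' _ (Finset.mem_filter.2 ⟨hV y hy, hyA⟩)
    refine hBA n (ih hB hBneg (Nat.le_of_lt_succ ((Finset.card_lt_card ?_).trans_le hcard)))
    refine (Finset.ssubset_iff_of_subset fun a ha => ?_).2 ⟨_, W.max'_mem hW, fun hmem => ?_⟩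
    · obtain ⟨haV, x, hx, hax⟩ := Finset.mem_filter.1 ha
      obtain ⟨z, hz, hxz⟩ := (hBlow x hx).2
      exact Finset.mem_filter.2 ⟨haV, z, hz, hax.trans hxz⟩
    · obtain ⟨-, x, hx, hxc⟩ := Finset.mem_filter.1 hmem
      exact ((hBlow x hx).1.trans_le hxc).false

end DescentSystem

namespace DiscreteFractional

variable {d : ℕ}

/-! ### The discrete fractional Laplacian as an operator on `ℓ²` -/

theorem conj_character_mul_character (x y : Lattice d) (θ : Fin d → ℝ) :
    (starRingEnd ℂ) (character x θ) * character y θ = character (y - x) θ := by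
  have hpairing : pairing (y - x) θ = -pairing x θ + pairing y θ := by
    simp only [pairing, Pi.sub_apply, Int.cast_sub, sub_mul, Finset.sum_sub_distrib]
    ring
  simp only [character]
  rw [← Complex.exp_conj, ← Complex.exp_add, hpairing]
  congr 1
  simp only [map_mul, Complex.conj_I, Complex.conj_ofReal]
  push_cast
  ring

theorem integral_exp_int_mul (n : ℤ) :
    ∫ t in Icc (-Real.pi) Real.pi, Complex.exp (Complex.I * ((n : ℝ) * t : ℝ)) =
      if n = 0 then (2 * Real.pi : ℂ) else 0 := by
  rw [integral_Icc_eq_integral_Ioc, ← intervalIntegral.integral_of_le (by linarith [Real.pi_pos])]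
  split_ifs with h
  · simp [h, two_mul]
  · have hIn : (Complex.I * n : ℂ) ≠ 0 := mul_ne_zero Complex.I_ne_zero (by exact_mod_cast h)
    simp only [Complex.ofReal_mul, Complex.ofReal_intCast, ← mul_assoc]
    rw [integral_exp_mul_complex hIn, div_eq_zero_iff]
    left
    rw [sub_eq_zero, Complex.exp_eq_exp_iff_exists_int]
    refine ⟨n, ?_⟩
    push_cast
    ring

theorem integral_character (x : Lattice d) :
    ∫ θ in cube d, character x θ = if x = 0 then (2 * Real.pi : ℂ) ^ d else 0 := by
  have hmeasure : volume.restrict (cube d) =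
      Measure.pi fun _ : Fin d => volume.restrict (Icc (-Real.pi) Real.pi) := by
    rw [← Measure.restrict_pi_pi, pi_univ_Icc]
    rfl
  have hprod : ∀ θ, character x θ = ∏ i, Complex.exp (Complex.I * ((x i : ℝ) * θ i : ℝ)) := by
    intro θ
    rw [character, ← Complex.exp_sum, pairing]
    push_cast
    rw [Finset.mul_sum]
  simp only [hprod]
  rw [hmeasure, integral_fintype_prod_eq_prod (𝕜 := ℂ)
    (f := fun i t => Complex.exp (Complex.I * ((x i : ℝ) * t : ℝ)))]
  simp only [integral_exp_int_mul]
  split_ifs with h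
  · simp [h]
  · obtain ⟨i, hi⟩ := Function.ne_iff.1 h
    exact Finset.prod_eq_zero (Finset.mem_univ i) (if_neg hi)

/-- The exponential `e^{i x·θ}` as an element of `L²([-π, π]^d)`. -/
def mode (x : Lattice d) : Lp ℂ 2 (cubeMeasure d) := (memLp_character x).toLp (character x)

theorem coeFn_mode (x : Lattice d) : mode x =ᵐ[cubeMeasure d] character x :=
  MemLp.coeFn_toLp _

theorem inner_mode_mode (x y : Lattice d) :
    inner ℂ (mode x) (mode y) = if x = y then (2 * Real.pi : ℂ) ^ d else 0 := by
  have hinner : ∫ θ, inner ℂ (mode x θ) (mode y θ) ∂(cubeMeasure d) =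
      ∫ θ in cube d, character (y - x) θ := by
    refine integral_congr_ae ?_
    filter_upwards [coeFn_mode x, coeFn_mode y] with θ hx hy
    rw [hx, hy, ← conj_character_mul_character, RCLike.inner_apply, mul_comm]
  rw [L2.inner_def, hinner, integral_character]
  simp only [sub_eq_zero, eq_comm]

/-- The norm `(2π)^{d/2}` of the exponentials in `L²([-π, π]^d)`. -/
def modeNorm (d : ℕ) : ℝ := Real.sqrt ((2 * Real.pi) ^ d)

theorem modeNorm_ne_zero : ((modeNorm d : ℝ) : ℂ) ≠ 0 :=
  Complex.ofReal_ne_zero.2 (Real.sqrt_pos.2 (by positivity)).ne'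

theorem modeNorm_mul_self : ((modeNorm d : ℝ) : ℂ) * modeNorm d = (2 * Real.pi : ℂ) ^ d := by
  have hreal : modeNorm d * modeNorm d = (2 * Real.pi) ^ d := Real.mul_self_sqrt (by positivity)
  exact_mod_cast hreal

/-- The exponential `e^{i x·θ}` normalized in `L²([-π, π]^d)`. -/
def unitMode (x : Lattice d) : Lp ℂ 2 (cubeMeasure d) :=
  ((modeNorm d : ℝ) : ℂ)⁻¹ • mode x

theorem orthonormal_unitMode : Orthonormal ℂ (unitMode (d := d)) := by
  classical
  rw [orthonormal_iff_ite]
  intro x y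
  rw [unitMode, unitMode, inner_smul_left, inner_smul_right, inner_mode_mode]
  split_ifs
  · rw [← modeNorm_mul_self, map_inv₀, Complex.conj_ofReal]
    field_simp [modeNorm_ne_zero (d := d)]
  · simp

/-- The complex sequence space `ℓ²(ℤ^d)`. -/
abbrev CEll2 (d : ℕ) : Type := lp (fun _ : Lattice d => ℂ) 2

/-- The Fourier transform on complex sequences, normalized to be isometric. -/
def unitFourier (d : ℕ) : CEll2 d →ₗᵢ[ℂ] Lp ℂ 2 (cubeMeasure d) :=
  (orthonormal_unitMode (d := d)).orthogonalFamily.linearIsometry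

theorem unitFourier_single [DecidableEq (Lattice d)] (x : Lattice d) :
    unitFourier d (lp.single 2 x (1 : ℂ)) = unitMode x := by
  have hsingle := OrthogonalFamily.linearIsometry_apply_single
    (orthonormal_unitMode (d := d)).orthogonalFamily (i := x) (1 : ℂ)
  rwa [LinearIsometry.toSpanSingleton_apply, one_smul] at hsingle

/-- The inclusion of real sequences into complex sequences. -/
def complexify (d : ℕ) : Ell2 d →L[ℝ] CEll2 d :=
  LinearMap.mkContinuous
    { toFun := fun u => ⟨fun x => ((u x : ℝ) : ℂ), (lp.memℓp u).mono' fun x => by simp⟩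
      map_add' := fun u v => by ext x; exact Complex.ofReal_add _ _
      map_smul' := fun a u => by ext x; simp } 1 fun u => by
    rw [one_mul]
    exact lp.norm_mono (by norm_num) fun x => by simp

@[simp] theorem complexify_apply (u : Ell2 d) (x : Lattice d) : complexify d u x = (u x : ℂ) := rfl

/-- The real part of a complex sequence. -/
def realPart (d : ℕ) : CEll2 d →L[ℝ] Ell2 d :=
  LinearMap.mkContinuous
    { toFun := fun u => ⟨fun x => (u x).re, (lp.memℓp u).mono' fun x => Complex.abs_re_le_norm _⟩
      map_add' := fun u v => by ext x; exact Complex.add_re _ _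
      map_smul' := fun a u => by ext x; simp } 1 fun u => by
    rw [one_mul]
    exact lp.norm_mono (by norm_num) fun x => Complex.abs_re_le_norm _

@[simp] theorem realPart_apply (u : CEll2 d) (x : Lattice d) : realPart d u x = (u x).re := rfl

theorem inner_realPart (a : CEll2 d) (w : Ell2 d) :
    inner ℝ (realPart d a) w = (inner ℂ a (complexify d w)).re := by
  refine (lp.hasSum_inner (𝕜 := ℝ) (realPart d a) w).unique ?_
  convert! Complex.hasSum_re (lp.hasSum_inner (𝕜 := ℂ) a (complexify d w)) using 2 with x
  simp [RCLike.inner_apply]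

theorem hasSum_fourier (u : Ell2 d) :
    HasSum (fun x => (u x : ℂ) • mode x) ((modeNorm d : ℂ) • unitFourier d (complexify d u)) := by
  have hterm : (fun x => (u x : ℂ) • mode x) = fun x => (modeNorm d : ℂ) •
      LinearIsometry.toSpanSingleton ℂ (Lp ℂ 2 (cubeMeasure d)) (orthonormal_unitMode.1 x)
        (complexify d u x) := by
    funext x
    rw [LinearIsometry.toSpanSingleton_apply, complexify_apply, unitMode, smul_smul, smul_smul,
      mul_right_comm, mul_inv_cancel₀ modeNorm_ne_zero, one_mul]
  rw [hterm]
  exact (OrthogonalFamily.hasSum_linearIsometry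
    (orthonormal_unitMode (d := d)).orthogonalFamily (complexify d u)).const_smul (modeNorm d : ℂ)

theorem fourier_eq_smul_unitFourier (u : Ell2 d) :
    fourier u = (modeNorm d : ℂ) • unitFourier d (complexify d u) :=
  (hasSum_fourier u).tsum_eq

theorem symbol_nonneg (θ : Fin d → ℝ) : 0 ≤ symbol θ :=
  Finset.sum_nonneg fun i _ => by positivity

theorem symbol_le (θ : Fin d → ℝ) : symbol θ ≤ 4 * d := by
  have hsum : symbol θ ≤ ∑ _i : Fin d, (4 : ℝ) :=
    Finset.sum_le_sum fun i _ => by nlinarith [Real.sin_sq_le_one (θ i / 2)]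
  simpa [mul_comm] using hsum

theorem symbol_neg (θ : Fin d → ℝ) : symbol (-θ) = symbol θ := by
  simp [symbol, neg_div]

theorem measurable_symbol_rpow (α : ℝ) : Measurable fun θ : Fin d → ℝ => symbol θ ^ α := by
  have hsymbol : Measurable fun θ : Fin d → ℝ => symbol θ := by unfold symbol; fun_prop
  exact hsymbol.pow_const α

theorem symbol_rpow_le {α : ℝ} (hα : 0 ≤ α) (θ : Fin d → ℝ) : symbol θ ^ α ≤ (4 * d) ^ α :=
  Real.rpow_le_rpow (symbol_nonneg θ) (symbol_le θ) hα

theorem memLp_symbol_rpow {α : ℝ} (hα : 0 ≤ α) :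
    MemLp (fun θ => ((symbol θ ^ α : ℝ) : ℂ)) ⊤ (cubeMeasure d) := by
  refine memLp_top_of_bound
    (Complex.measurable_ofReal.comp (measurable_symbol_rpow α)).aestronglyMeasurable
    ((4 * d) ^ α) (Filter.Eventually.of_forall fun θ => ?_)
  rw [Complex.norm_real, Real.norm_of_nonneg (Real.rpow_nonneg (symbol_nonneg θ) α)]
  exact symbol_rpow_le hα θ

/-- Multiplication by `Φ^α` on `L²([-π, π]^d)`. -/
def multiplier {α : ℝ} (hα : 0 ≤ α) : Lp ℂ 2 (cubeMeasure d) →L[ℂ] Lp ℂ 2 (cubeMeasure d) :=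
  (ContinuousLinearMap.lsmul ℂ ℂ).holderL (cubeMeasure d) ⊤ 2 2 (memLp_symbol_rpow hα).toLp

theorem coeFn_multiplier {α : ℝ} (hα : 0 ≤ α) (v : Lp ℂ 2 (cubeMeasure d)) :
    multiplier hα v =ᵐ[cubeMeasure d] fun θ => ((symbol θ ^ α : ℝ) : ℂ) * v θ := by
  filter_upwards [(ContinuousLinearMap.lsmul ℂ ℂ).coeFn_holder (r := 2)
    (memLp_symbol_rpow (d := d) hα).toLp v, (memLp_symbol_rpow (d := d) hα).coeFn_toLp]
    with θ hholder hsymbol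
  rwa [hsymbol] at hholder

theorem inner_multiplier {α : ℝ} (hα : 0 ≤ α) (v w : Lp ℂ 2 (cubeMeasure d)) :
    inner ℂ v (multiplier hα w) =
      ∫ θ in cube d, ((symbol θ ^ α : ℝ) : ℂ) * (w θ * (starRingEnd ℂ) (v θ)) := by
  rw [L2.inner_def]
  refine integral_congr_ae ?_
  filter_upwards [coeFn_multiplier hα w] with θ hθ
  rw [hθ, RCLike.inner_apply, mul_assoc]

theorem inner_multiplier_left {α : ℝ} (hα : 0 ≤ α) (v w : Lp ℂ 2 (cubeMeasure d)) :
    inner ℂ (multiplier hα v) w = inner ℂ v (multiplier hα w) := by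
  rw [L2.inner_def, L2.inner_def]
  refine integral_congr_ae ?_
  filter_upwards [coeFn_multiplier hα w, coeFn_multiplier hα v] with θ hw hv
  rw [hw, hv, RCLike.inner_apply, RCLike.inner_apply, map_mul, Complex.conj_ofReal]
  ring

theorem re_inner_multiplier_self_nonneg {α : ℝ} (hα : 0 ≤ α) (v : Lp ℂ 2 (cubeMeasure d)) :
    0 ≤ (inner ℂ v (multiplier hα v)).re := by
  have hreal : inner ℂ v (multiplier hα v) =
      ((∫ θ in cube d, symbol θ ^ α * ‖v θ‖ ^ 2 : ℝ) : ℂ) := by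
    rw [inner_multiplier, ← integral_complex_ofReal]
    refine integral_congr_ae (Filter.Eventually.of_forall fun θ => ?_)
    simp only [Complex.mul_conj, Complex.normSq_eq_norm_sq]
    push_cast
    rfl
  rw [hreal, Complex.ofReal_re]
  exact integral_nonneg fun θ =>
    mul_nonneg (Real.rpow_nonneg (symbol_nonneg θ) α) (sq_nonneg _)

/-- The fractional Laplacian on complex sequences. -/
def complexLaplacian {α : ℝ} (hα : 0 ≤ α) : CEll2 d →L[ℂ] CEll2 d :=
  (ContinuousLinearMap.adjoint (unitFourier d).toContinuousLinearMap) ∘L (multiplier hα) ∘L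
    (unitFourier d).toContinuousLinearMap

theorem inner_complexLaplacian {α : ℝ} (hα : 0 ≤ α) (u w : CEll2 d) :
    inner ℂ w (complexLaplacian hα u) =
      inner ℂ (unitFourier d w) (multiplier hα (unitFourier d u)) := by
  simp only [complexLaplacian, ContinuousLinearMap.comp_apply,
    ContinuousLinearMap.adjoint_inner_right, LinearIsometry.coe_toContinuousLinearMap]

theorem complexLaplacian_apply {α : ℝ} (hα : 0 ≤ α) (u : CEll2 d) (x : Lattice d) :
    complexLaplacian hα u x = inner ℂ (unitMode x) (multiplier hα (unitFourier d u)) := by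
  classical
  rw [← unitFourier_single, ← inner_complexLaplacian, lp.inner_single_left]
  simp

theorem fracLaplacian_eq_complexLaplacian {α : ℝ} (hα : 0 ≤ α) (u : Ell2 d) (x : Lattice d) :
    fracLaplacian α u x = complexLaplacian hα (complexify d u) x := by
  have hfourier : multiplier hα (unitFourier d (complexify d u)) =
      (modeNorm d : ℂ)⁻¹ • multiplier hα (fourier u) := by
    rw [fourier_eq_smul_unitFourier, map_smul, smul_smul, inv_mul_cancel₀ modeNorm_ne_zero,
      one_smul]
  rw [complexLaplacian_apply, hfourier, unitMode, inner_smul_left, inner_smul_right, ← mul_assoc,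
    map_inv₀, Complex.conj_ofReal, ← mul_inv, modeNorm_mul_self, fracLaplacian, fourierInv,
    one_div, inner_multiplier]
  congr 1
  refine integral_congr_ae ?_
  filter_upwards [coeFn_mode x] with θ hθ
  rw [hθ, mul_assoc, character, ← Complex.exp_conj]
  congr 3
  simp

/-- The convolution kernel of the fractional Laplacian. -/
def kernel (d : ℕ) (α : ℝ) (x : Lattice d) : ℝ :=
  (((2 * Real.pi : ℂ) ^ d)⁻¹ * ∫ θ in cube d, ((symbol θ ^ α : ℝ) : ℂ) * character x θ).re

theorem measurePreserving_neg_cube (d : ℕ) :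
    MeasurePreserving (fun θ : Fin d → ℝ => -θ) (cubeMeasure d) (cubeMeasure d) := by
  have hcube : Neg.neg ⁻¹' cube d = cube d := by
    simp [cube, neg_preimage, Pi.neg_def]
  have hneg := (Measure.measurePreserving_neg (volume : Measure (Fin d → ℝ))).restrict_preimage
    (s := cube d) measurableSet_Icc
  rwa [hcube] at hneg

theorem conj_integral_symbol_mul_character (α : ℝ) (x : Lattice d) :
    (starRingEnd ℂ) (∫ θ in cube d, ((symbol θ ^ α : ℝ) : ℂ) * character x θ) =
      ∫ θ in cube d, ((symbol θ ^ α : ℝ) : ℂ) * character x θ := by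
  rw [← integral_conj,
    ← (measurePreserving_neg_cube d).integral_comp (MeasurableEquiv.neg _).measurableEmbedding]
  refine integral_congr_ae (Filter.Eventually.of_forall fun θ => ?_)
  simp only [map_mul, Complex.conj_ofReal, symbol_neg]
  congr 1
  rw [character, character, ← Complex.exp_conj]
  congr 1
  simp [pairing]

theorem complexLaplacian_single [DecidableEq (Lattice d)] {α : ℝ} (hα : 0 ≤ α)
    (x y : Lattice d) :
    complexLaplacian hα (lp.single 2 y (1 : ℂ)) x = (kernel d α (y - x) : ℂ) := by
  have hmodes :
      ∫ θ in cube d, ((symbol θ ^ α : ℝ) : ℂ) * (mode y θ * (starRingEnd ℂ) (mode x θ)) =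
        ∫ θ in cube d, ((symbol θ ^ α : ℝ) : ℂ) * character (y - x) θ := by
    refine integral_congr_ae ?_
    filter_upwards [coeFn_mode x, coeFn_mode y] with θ hx hy
    rw [hx, hy, mul_comm (character y θ), conj_character_mul_character]
  rw [complexLaplacian_apply, unitFourier_single, unitMode, unitMode, map_smul, inner_smul_left,
    inner_smul_right, ← mul_assoc, map_inv₀, Complex.conj_ofReal, ← mul_inv, modeNorm_mul_self,
    inner_multiplier, hmodes, kernel]
  refine (Complex.conj_eq_iff_re.1 ?_).symm
  rw [map_mul, conj_integral_symbol_mul_character]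
  simp [map_ofNat]

theorem hasSum_complexLaplacian {α : ℝ} (hα : 0 ≤ α) (u : Ell2 d) (x : Lattice d) :
    HasSum (fun y => ((u y * kernel d α (y - x) : ℝ) : ℂ))
      (complexLaplacian hα (complexify d u) x) := by
  classical
  have hsum := ((lp.hasSum_single (E := fun _ : Lattice d => ℂ) (p := 2) (by norm_num)
    (complexify d u)).mapL (complexLaplacian hα)).mapL (lp.evalCLM ℂ (fun _ => ℂ) 2 x)
  refine hsum.congr_fun fun y => ?_
  have hsingle : (lp.single 2 y (complexify d u y) : CEll2 d) =
      (u y : ℂ) • lp.single 2 y (1 : ℂ) := by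
    rw [← lp.single_smul]
    simp
  rw [hsingle, map_smul, map_smul]
  change _ = (u y : ℂ) * complexLaplacian hα (lp.single 2 y (1 : ℂ)) x
  rw [complexLaplacian_single]
  simp

/-- The fractional Laplacian on real sequences. -/
def laplacian {α : ℝ} (hα : 0 ≤ α) : Ell2 d →L[ℝ] Ell2 d :=
  realPart d ∘L (complexLaplacian hα).restrictScalars ℝ ∘L complexify d

theorem hasSum_laplacian {α : ℝ} (hα : 0 ≤ α) (u : Ell2 d) (x : Lattice d) :
    HasSum (fun y => u y * kernel d α (y - x)) (laplacian hα u x) :=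
  Complex.hasSum_re (hasSum_complexLaplacian hα u x)

theorem fracLaplacian_eq_laplacian {α : ℝ} (hα : 0 ≤ α) (u : Ell2 d) (x : Lattice d) :
    fracLaplacian α u x = (laplacian hα u x : ℂ) := by
  rw [fracLaplacian_eq_complexLaplacian hα]
  exact (hasSum_complexLaplacian hα u x).unique (Complex.hasSum_ofReal.2 (hasSum_laplacian hα u x))

theorem inner_laplacian {α : ℝ} (hα : 0 ≤ α) (u w : Ell2 d) :
    inner ℝ (laplacian hα u) w =
      (inner ℂ (unitFourier d (complexify d w))
        (multiplier hα (unitFourier d (complexify d u)))).re := by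
  rw [← inner_complexLaplacian, ← inner_conj_symm (𝕜 := ℂ), Complex.conj_re]
  exact inner_realPart _ w

theorem inner_laplacian_comm {α : ℝ} (hα : 0 ≤ α) (u w : Ell2 d) :
    inner ℝ (laplacian hα u) w = inner ℝ u (laplacian hα w) := by
  rw [real_inner_comm (laplacian hα w) u, inner_laplacian, inner_laplacian,
    ← inner_multiplier_left, ← inner_conj_symm (𝕜 := ℂ), Complex.conj_re]

theorem inner_laplacian_self_nonneg {α : ℝ} (hα : 0 ≤ α) (u : Ell2 d) :
    0 ≤ inner ℝ (laplacian hα u) u := by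
  rw [inner_laplacian]
  exact re_inner_multiplier_self_nonneg hα _

theorem mem_HAlpha {α : ℝ} (hα : 0 ≤ α) {h : Lattice d → ℝ} {b : ℝ} (hh : ∀ x, |h x| ≤ b)
    (u : Ell2 d) : u ∈ HAlpha α h := by
  constructor
  · have hfourier : Integrable (fun θ => ‖fourier u θ‖ ^ 2) (cubeMeasure d) :=
      (Lp.memLp (fourier u)).integrable_norm_pow (by norm_num)
    refine hfourier.bdd_mul (c := (4 * d) ^ α) (measurable_symbol_rpow α).aestronglyMeasurable
      (Filter.Eventually.of_forall fun θ => ?_)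
    rw [Real.norm_of_nonneg (Real.rpow_nonneg (symbol_nonneg θ) α)]
    exact symbol_rpow_le hα θ
  · have hsq : Summable fun x => |u x| ^ 2 := by
      simpa using (lp.memℓp u).summable (by norm_num)
    refine .of_norm_bounded (hsq.mul_left b) fun x => ?_
    rw [norm_mul, Real.norm_eq_abs, Real.norm_of_nonneg (sq_nonneg _)]
    exact mul_le_mul_of_nonneg_right (hh x) (sq_nonneg _)

/-- The translation `u ↦ u(· - y)` of sequences. -/
def shift (y : Lattice d) : Ell2 d →ₗᵢ[ℝ] Ell2 d where
  toFun u := ⟨fun x => u (x - y), by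
    refine memℓp_gen ?_
    exact ((Equiv.subRight y).summable_iff (f := fun x => ‖u x‖ ^ (2 : ENNReal).toReal)).2
      ((lp.memℓp u).summable (by norm_num))⟩
  map_add' _ _ := rfl
  map_smul' _ _ := rfl
  norm_map' u := by
    have htwo : (0 : ℝ) < (2 : ENNReal).toReal := by norm_num
    rw [lp.norm_eq_tsum_rpow htwo, lp.norm_eq_tsum_rpow htwo]
    congr 1
    exact (Equiv.subRight y).tsum_eq fun x => ‖u x‖ ^ (2 : ENNReal).toReal

@[simp] theorem shift_apply (y : Lattice d) (u : Ell2 d) (x : Lattice d) :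
    shift y u x = u (x - y) := rfl

theorem laplacian_shift {α : ℝ} (hα : 0 ≤ α) (y : Lattice d) (u : Ell2 d) :
    laplacian hα (shift y u) = shift y (laplacian hα u) := by
  ext x
  refine (hasSum_laplacian hα (shift y u) x).unique ?_
  rw [shift_apply, ← (Equiv.addRight y).hasSum_iff]
  convert! hasSum_laplacian hα u (x - y) using 2 with z
  simp [sub_sub_eq_add_sub]

/-! ### The variational problem -/

theorem abs_apply_le_norm (u : Ell2 d) (x : Lattice d) : |u x| ≤ ‖u‖ :=
  lp.norm_apply_le_norm (by norm_num) u x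

theorem hasSum_inner_mul (u w : Ell2 d) :
    HasSum (fun x => u x * w x) (inner ℝ u w) := by
  simpa [RCLike.inner_apply, mul_comm] using lp.hasSum_inner (𝕜 := ℝ) u w

theorem exists_apply_ne_zero {v : Ell2 d} (hv : v ≠ 0) : ∃ x, v x ≠ 0 := by
  by_contra! h
  exact hv (lp.ext (funext h))

theorem norm_le_of_abs_le {u w : Ell2 d} {a : ℝ} (ha : 0 ≤ a)
    (h : ∀ x, |u x| ≤ a * |w x|) : ‖u‖ ≤ a * ‖w‖ := by
  have hsmul : ‖u‖ ≤ ‖a • w‖ := lp.norm_mono (by norm_num) fun x => by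
    simpa [abs_mul, abs_of_nonneg ha] using h x
  rwa [norm_smul, Real.norm_of_nonneg ha] at hsmul

/-- The equation `T u = u g(u)` on the lattice: a coercive symmetric operator `T` commuting with
translations and an even function `g`, increasing on `[0, ∞)`, together with a superquadratic
primitive `prim` of `s ↦ s g(s)`. That `prim` is a primitive enters only through its subgradient
inequality `prim_sub` in the variable `s²`. -/
structure Problem (d : ℕ) where
  /-- the linear part -/
  T : Ell2 d →L[ℝ] Ell2 d
  /-- the coercivity constant -/
  c : ℝ
  /-- the quotient of the nonlinearity by its argument -/
  g : ℝ → ℝ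
  /-- the primitive of the nonlinearity -/
  prim : ℝ → ℝ
  c_pos : 0 < c
  T_symm : ∀ u w, inner ℝ (T u) w = inner ℝ u (T w)
  T_coercive : ∀ u, c * ‖u‖ ^ 2 ≤ inner ℝ (T u) u
  T_shift : ∀ y u, T (shift y u) = shift y (T u)
  g_continuous : Continuous g
  g_neg : ∀ s, g (-s) = g s
  g_zero : g 0 = 0
  g_strictMono : StrictMonoOn g (Ici 0)
  prim_zero : prim 0 = 0
  prim_sub : ∀ a b, g a * (b ^ 2 - a ^ 2) / 2 ≤ prim b - prim a
  prim_superquadratic : ∀ M, ∃ R, 0 < R ∧ ∀ s, R < |s| → M * s ^ 2 ≤ prim s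

namespace Problem

variable (p : Problem d)

theorem g_abs (s : ℝ) : p.g |s| = p.g s := by
  rcases abs_choice s with h | h <;> rw [h]
  exact p.g_neg s

theorem g_le_of_abs_le {s t : ℝ} (h : |s| ≤ t) : p.g s ≤ p.g t := by
  rw [← p.g_abs s]
  exact p.g_strictMono.monotoneOn (abs_nonneg s) ((abs_nonneg s).trans h) h

theorem g_lt_of_abs_lt {s t : ℝ} (h : |s| < |t|) : p.g s < p.g t := by
  rw [← p.g_abs s, ← p.g_abs t]
  exact p.g_strictMono (abs_nonneg s) (abs_nonneg t) h

theorem g_nonneg (s : ℝ) : 0 ≤ p.g s := by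
  simpa [p.g_zero, p.g_abs] using p.g_le_of_abs_le (s := 0) (t := |s|) (by simp)

theorem prim_nonneg (s : ℝ) : 0 ≤ p.prim s := by
  simpa [p.g_zero, p.prim_zero] using p.prim_sub 0 s

theorem prim_le (s : ℝ) : p.prim s ≤ p.g s * s ^ 2 / 2 := by
  have hsub := p.prim_sub s 0
  rw [p.prim_zero] at hsub
  linarith

theorem prim_neg (s : ℝ) : p.prim (-s) = p.prim s := by
  have hle := p.prim_sub s (-s)
  have hge := p.prim_sub (-s) s
  simp only [neg_sq, sub_self, mul_zero, zero_div] at hle hge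
  linarith

theorem exists_lt_g (M : ℝ) : ∃ R, 0 < R ∧ ∀ s, R < |s| → M < p.g s := by
  obtain ⟨R, hR, hprim⟩ := p.prim_superquadratic (|M| + 1)
  refine ⟨R, hR, fun s hs => ?_⟩
  have hsq : 0 < s ^ 2 := sq_pos_of_ne_zero (abs_pos.1 (hR.trans hs))
  have hhalf : |M| + 1 ≤ p.g s / 2 :=
    le_of_mul_le_mul_right (by linarith [hprim s hs, p.prim_le s]) hsq
  linarith [le_abs_self M, abs_nonneg M]

theorem exists_g_le {ε : ℝ} (hε : 0 < ε) : ∃ δ, 0 < δ ∧ ∀ s, |s| ≤ δ → p.g s ≤ ε := by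
  have hsmall : ∀ᶠ s in 𝓝 (0 : ℝ), p.g s < ε :=
    p.g_continuous.continuousAt.eventually_lt_const (by rwa [p.g_zero])
  obtain ⟨δ, hδ, h⟩ := Metric.eventually_nhds_iff.1 hsmall
  refine ⟨δ / 2, by positivity, fun s hs => (h ?_).le⟩
  rw [Real.dist_eq, sub_zero]
  linarith

theorem exists_g_sub_lt (R : ℝ) {ε : ℝ} (hε : 0 < ε) : ∃ δ, 0 < δ ∧ ∀ s t, |s| ≤ R → |t| ≤ R →
    |s - t| < δ → |p.g s - p.g t| < ε := by
  have huniform := isCompact_Icc.uniformContinuousOn_of_continuous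
    (p.g_continuous.continuousOn (s := Icc (-R) R))
  obtain ⟨δ, hδ, h⟩ := Metric.uniformContinuousOn_iff.1 huniform ε hε
  exact ⟨δ, hδ, fun s t hs ht hst => h s (abs_le.1 hs) t (abs_le.1 ht) hst⟩

/-- The operator of multiplication by `g(u)` on `ℓ²`. -/
def mulOp (u : Ell2 d) : Ell2 d →L[ℝ] Ell2 d :=
  LinearMap.mkContinuous
    { toFun := fun w => ⟨fun x => p.g (u x) * w x, by
        refine (lp.memℓp (p.g ‖u‖ • w)).mono' fun x => ?_
        rw [lp.coeFn_smul, Pi.smul_apply, norm_mul, norm_smul, Real.norm_of_nonneg (p.g_nonneg _),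
          Real.norm_of_nonneg (p.g_nonneg _)]
        exact mul_le_mul_of_nonneg_right (p.g_le_of_abs_le (abs_apply_le_norm u x)) (norm_nonneg _)⟩
      map_add' := fun v w => by ext x; exact mul_add _ _ _
      map_smul' := fun a w => by ext x; simp [mul_left_comm] } (p.g ‖u‖) fun w => by
    refine norm_le_of_abs_le (p.g_nonneg _) fun x => ?_
    simp only [LinearMap.coe_mk, AddHom.coe_mk]
    rw [abs_mul, abs_of_nonneg (p.g_nonneg _)]
    exact mul_le_mul_of_nonneg_right (p.g_le_of_abs_le (abs_apply_le_norm u x)) (abs_nonneg _)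

@[simp] theorem mulOp_apply (u w : Ell2 d) (x : Lattice d) : p.mulOp u w x = p.g (u x) * w x := rfl

theorem norm_mulOp_apply_le {u : Ell2 d} {σ : ℝ} (hu : ∀ x, |u x| ≤ σ) (w : Ell2 d) :
    ‖p.mulOp u w‖ ≤ p.g σ * ‖w‖ :=
  norm_le_of_abs_le (p.g_nonneg _) fun x => by
    rw [mulOp_apply, abs_mul, abs_of_nonneg (p.g_nonneg _)]
    exact mul_le_mul_of_nonneg_right (p.g_le_of_abs_le (hu x)) (abs_nonneg _)

theorem mulOp_neg (u : Ell2 d) : p.mulOp (-u) = p.mulOp u := by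
  ext w x
  simp [p.g_neg]

theorem mulOp_symm (u w z : Ell2 d) : inner ℝ (p.mulOp u w) z = inner ℝ w (p.mulOp u z) := by
  refine (hasSum_inner_mul (p.mulOp u w) z).unique ?_
  convert! hasSum_inner_mul w (p.mulOp u z) using 2 with x
  simp only [mulOp_apply]
  ring

theorem hasSum_mulOp (u w : Ell2 d) :
    HasSum (fun x => p.g (u x) * w x ^ 2) (inner ℝ (p.mulOp u w) w) := by
  convert! hasSum_inner_mul (p.mulOp u w) w using 2 with x
  simp only [mulOp_apply]
  ring

theorem inner_mulOp_nonneg (u w : Ell2 d) : 0 ≤ inner ℝ (p.mulOp u w) w :=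
  (p.hasSum_mulOp u w).nonneg fun _ => mul_nonneg (p.g_nonneg _) (sq_nonneg _)

theorem inner_mulOp_le {u : Ell2 d} {σ : ℝ} (hu : ∀ x, |u x| ≤ σ) (w : Ell2 d) :
    inner ℝ (p.mulOp u w) w ≤ p.g σ * ‖w‖ ^ 2 := by
  refine (real_inner_le_norm _ _).trans ?_
  nlinarith [p.norm_mulOp_apply_le hu w, norm_nonneg w]

theorem norm_mulOp_sub_le {u w : Ell2 d} {η : ℝ} (hη : 0 ≤ η)
    (hg : ∀ x, |p.g (u x) - p.g (w x)| ≤ η) : ‖p.mulOp u - p.mulOp w‖ ≤ η := by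
  refine ContinuousLinearMap.opNorm_le_bound _ hη fun z => norm_le_of_abs_le hη fun x => ?_
  have hdiff : (p.mulOp u - p.mulOp w) z x = (p.g (u x) - p.g (w x)) * z x := by
    simp [sub_mul]
  rw [hdiff, abs_mul]
  exact mul_le_mul_of_nonneg_right (hg x) (abs_nonneg _)

theorem continuous_mulOp : Continuous p.mulOp := by
  rw [Metric.continuous_iff]
  intro u ε hε
  obtain ⟨δ, hδ, hg⟩ := p.exists_g_sub_lt (‖u‖ + 1) (half_pos hε)
  refine ⟨min δ 1, by positivity, fun w hw => ?_⟩
  rw [dist_eq_norm] at hw ⊢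
  have hw_norm : ‖w‖ ≤ ‖u‖ + 1 := by
    linarith [norm_le_norm_add_norm_sub' w u, hw.trans_le (min_le_right _ _)]
  refine (p.norm_mulOp_sub_le (half_pos hε).le fun x => ?_).trans_lt (half_lt_self hε)
  refine (hg _ _ ((abs_apply_le_norm w x).trans hw_norm)
    ((abs_apply_le_norm u x).trans (by linarith)) ?_).le
  exact (abs_apply_le_norm (w - u) x).trans_lt (hw.trans_le (min_le_left _ _))

/-- The nonlinearity `u ↦ u g(u)` on `ℓ²`. -/
def nonlin (u : Ell2 d) : Ell2 d := p.mulOp u u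

theorem continuous_nonlin : Continuous p.nonlin := p.continuous_mulOp.clm_apply continuous_id

@[simp] theorem nonlin_apply (u : Ell2 d) (x : Lattice d) : p.nonlin u x = p.g (u x) * u x := rfl

theorem nonlin_neg (u : Ell2 d) : p.nonlin (-u) = -p.nonlin u := by
  rw [nonlin, mulOp_neg, map_neg, nonlin]

theorem nonlin_shift (y : Lattice d) (u : Ell2 d) :
    p.nonlin (shift y u) = shift y (p.nonlin u) := by
  ext x
  simp

/-- The potential energy `∑ₓ prim (u x)`. -/
def potential (u : Ell2 d) : ℝ := ∑' x, p.prim (u x)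

theorem summable_prim (u : Ell2 d) : Summable fun x => p.prim (u x) :=
  .of_nonneg_of_le (fun _ => p.prim_nonneg _) (fun _ => p.prim_le _)
    ((p.hasSum_mulOp u u).summable.div_const 2)

theorem potential_sub_le (u w : Ell2 d) :
    (inner ℝ (p.mulOp u w) w - inner ℝ (p.mulOp u u) u) / 2 ≤ p.potential w - p.potential u := by
  refine hasSum_le (fun x => ?_) (((p.hasSum_mulOp u w).sub (p.hasSum_mulOp u u)).div_const 2)
    ((p.summable_prim w).hasSum.sub (p.summable_prim u).hasSum)
  rw [← mul_sub]
  exact p.prim_sub _ _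

theorem potential_zero : p.potential 0 = 0 := by simp [potential, p.prim_zero]

theorem potential_neg (u : Ell2 d) : p.potential (-u) = p.potential u := by
  simp [potential, p.prim_neg]

theorem potential_shift (y : Lattice d) (u : Ell2 d) :
    p.potential (shift y u) = p.potential u :=
  (Equiv.subRight y).tsum_eq fun x => p.prim (u x)

theorem potential_le (u : Ell2 d) : p.potential u ≤ inner ℝ (p.mulOp u u) u / 2 := by
  have hsub := p.potential_sub_le u 0
  simp only [potential_zero, map_zero, inner_zero_left] at hsub
  linarith

theorem continuous_potential : Continuous p.potential := by
  rw [continuous_iff_continuousAt]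
  intro u
  have hmul := p.continuous_mulOp
  have hww : Continuous fun w => p.mulOp w w := hmul.clm_apply continuous_id
  have hwu : Continuous fun w => p.mulOp w u := hmul.clm_apply continuous_const
  have hlower : Continuous fun w => p.potential u +
      (inner ℝ (p.mulOp u w) w - inner ℝ (p.mulOp u u) u) / 2 := by fun_prop
  have hupper : Continuous fun w => p.potential u +
      (inner ℝ (p.mulOp w w) w - inner ℝ (p.mulOp w u) u) / 2 := by fun_prop
  have hlower_lim := hlower.tendsto u
  have hupper_lim := hupper.tendsto u
  simp only [sub_self, zero_div, add_zero] at hlower_lim hupper_lim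
  refine tendsto_of_tendsto_of_tendsto_of_le_of_le hlower_lim hupper_lim (fun w => ?_) fun w => ?_
  · linarith [p.potential_sub_le u w]
  · linarith [p.potential_sub_le w u]

/-- The energy functional, whose critical points are the solutions of `T u = u g(u)`. -/
def action (u : Ell2 d) : ℝ := inner ℝ (p.T u) u / 2 - p.potential u

theorem continuous_action : Continuous p.action := by
  have := p.continuous_potential
  unfold action
  fun_prop

theorem action_zero : p.action 0 = 0 := by simp [action, p.potential_zero]

theorem action_neg (u : Ell2 d) : p.action (-u) = p.action u := by
  simp [action, p.potential_neg]

theorem action_shift (y : Lattice d) (u : Ell2 d) : p.action (shift y u) = p.action u := by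
  rw [action, action, p.T_shift, p.potential_shift, LinearIsometry.inner_map_map]

theorem le_action_of_abs_le {u : Ell2 d} {σ : ℝ} (hu : ∀ x, |u x| ≤ σ) :
    (p.c - p.g σ) / 2 * ‖u‖ ^ 2 ≤ p.action u := by
  rw [action]
  linarith [p.T_coercive u, p.potential_le u, p.inner_mulOp_le hu u]

theorem inner_T_pos {u : Ell2 d} (hu : u ≠ 0) : 0 < inner ℝ (p.T u) u :=
  (mul_pos p.c_pos (pow_pos (norm_pos_iff.2 hu) 2)).trans_le (p.T_coercive u)

theorem inner_T_le (u : Ell2 d) : inner ℝ (p.T u) u ≤ ‖p.T‖ * ‖u‖ ^ 2 := by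
  refine (real_inner_le_norm _ _).trans ?_
  nlinarith [p.T.le_opNorm u, norm_nonneg u]

/-- The Nehari condition: `u` is nonzero and the derivative of the action at `u` vanishes in the
direction `u`. -/
def Nehari (u : Ell2 d) : Prop := u ≠ 0 ∧ inner ℝ (p.mulOp u u) u = inner ℝ (p.T u) u

variable {p} in
theorem Nehari.action_le {u : Ell2 d} (hu : p.Nehari u) (w : Ell2 d) :
    p.action w ≤ p.action u + (inner ℝ (p.T w) w - inner ℝ (p.mulOp u w) w) / 2 := by
  have hsub := p.potential_sub_le u w
  rw [hu.2] at hsub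
  simp only [action]
  linarith

variable {p} in
theorem Nehari.action_smul_le {u : Ell2 d} (hu : p.Nehari u) (a : ℝ) :
    p.action (a • u) ≤ p.action u := by
  have hle := hu.action_le (a • u)
  simp only [map_smul, inner_smul_left, inner_smul_right, hu.2] at hle
  simpa using hle

variable {p} in
theorem Nehari.action_nonneg {u : Ell2 d} (hu : p.Nehari u) : 0 ≤ p.action u := by
  simpa [p.action_zero] using hu.action_smul_le 0

theorem exists_le_norm_of_nehari : ∃ ρ, 0 < ρ ∧ ∀ u, p.Nehari u → ρ ≤ ‖u‖ := by
  obtain ⟨ρ, hρ, hg⟩ := p.exists_g_le (half_pos p.c_pos)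
  refine ⟨ρ, hρ, fun u hu => ?_⟩
  by_contra! hlt
  have hsq : 0 < ‖u‖ ^ 2 := pow_pos (norm_pos_iff.2 hu.1) 2
  have hmul := p.inner_mulOp_le (abs_apply_le_norm u) u
  rw [hu.2] at hmul
  have hc : p.c ≤ p.g ‖u‖ := le_of_mul_le_mul_right ((p.T_coercive u).trans hmul) hsq
  linarith [p.c_pos, hg ‖u‖ (by rw [abs_norm]; exact hlt.le)]

variable {p} in
theorem Nehari.le_action_of_abs_le_mul_norm {u : Ell2 d} (hu : p.Nehari u) {β τ : ℝ} (hτ : 0 ≤ τ)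
    (hflat : ∀ x, |u x| ≤ β * ‖u‖) : (p.c - p.g (τ * β)) / 2 * τ ^ 2 ≤ p.action u := by
  have hu_norm : ‖u‖ ≠ 0 := norm_ne_zero_iff.2 hu.1
  have hscale : 0 ≤ τ / ‖u‖ := by positivity
  have hnorm : ‖(τ / ‖u‖) • u‖ = τ := by
    rw [norm_smul, Real.norm_of_nonneg hscale, div_mul_cancel₀ _ hu_norm]
  have hsup : ∀ x, |((τ / ‖u‖) • u) x| ≤ τ * β := by
    intro x
    rw [lp.coeFn_smul, Pi.smul_apply, smul_eq_mul, abs_mul, abs_of_nonneg hscale]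
    calc τ / ‖u‖ * |u x| ≤ τ / ‖u‖ * (β * ‖u‖) := mul_le_mul_of_nonneg_left (hflat x) hscale
      _ = τ * β := by field_simp
  have haction := p.le_action_of_abs_le hsup
  rw [hnorm] at haction
  exact haction.trans (hu.action_smul_le _)

variable {p} in
theorem Nehari.prim_apply_le {u : Ell2 d} (hu : p.Nehari u) (x : Lattice d) :
    p.prim (u x) ≤ ‖p.T‖ * ‖u‖ ^ 2 / 2 := by
  have hprim : p.prim (u x) ≤ p.potential u :=
    (p.summable_prim u).le_tsum x fun _ _ => p.prim_nonneg _
  have haction := hu.action_nonneg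
  rw [action] at haction
  linarith [p.inner_T_le u]

/-- A Nehari element is either flat, and then rescaling it to norm `τ` already forces its action
to be large, or it has a peak comparable to its norm, which superquadraticity bounds. -/
theorem exists_norm_le_of_nehari (D : ℝ) :
    ∃ R, 0 < R ∧ ∀ u, p.Nehari u → p.action u ≤ D → ‖u‖ ≤ R := by
  have hc := p.c_pos
  set τ := Real.sqrt (4 * (|D| + 1) / p.c) with hτ_def
  have hτ : 0 < τ := Real.sqrt_pos.2 (by positivity)
  have hτ_sq : p.c / 4 * τ ^ 2 = |D| + 1 := by
    rw [hτ_def, Real.sq_sqrt (by positivity)]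
    field_simp
  obtain ⟨δ, hδ, hg⟩ := p.exists_g_le (half_pos hc)
  set β := δ / τ with hβ_def
  have hβ : 0 < β := by positivity
  obtain ⟨R, hR, hprim⟩ := p.prim_superquadratic ((‖p.T‖ + 1) / β ^ 2)
  refine ⟨R / β, by positivity, fun u hu hD => ?_⟩
  by_contra! hlt
  by_cases hflat : ∀ x, |u x| ≤ β * ‖u‖
  · have haction := hu.le_action_of_abs_le_mul_norm hτ.le hflat
    have hgδ : p.g (τ * β) ≤ p.c / 2 :=
      hg _ (by rw [hβ_def, mul_div_cancel₀ _ hτ.ne', abs_of_pos hδ])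
    nlinarith [le_abs_self D, sq_nonneg τ]
  · push Not at hflat
    obtain ⟨x, hx⟩ := hflat
    have hpeak : (‖p.T‖ + 1) * ‖u‖ ^ 2 ≤ ‖p.T‖ * ‖u‖ ^ 2 / 2 :=
      calc (‖p.T‖ + 1) * ‖u‖ ^ 2 = (‖p.T‖ + 1) / β ^ 2 * (β * ‖u‖) ^ 2 := by field_simp
        _ ≤ (‖p.T‖ + 1) / β ^ 2 * u x ^ 2 := by
          rw [← sq_abs (u x)]
          gcongr
        _ ≤ p.prim (u x) := hprim (u x) (((div_lt_iff₀' hβ).1 hlt).trans hx)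
        _ ≤ ‖p.T‖ * ‖u‖ ^ 2 / 2 := hu.prim_apply_le x
    have hsq : 0 < ‖u‖ ^ 2 := pow_pos (norm_pos_iff.2 hu.1) 2
    nlinarith [mul_nonneg (norm_nonneg p.T) hsq.le]

/-! ### The radial projection onto the Nehari set -/

/-- The derivative of the action along the ray through `v` at `t v`, divided by `-t`. -/
def radial (t : ℝ) (v : Ell2 d) : ℝ :=
  inner ℝ (p.mulOp (t • v) v) v - inner ℝ (p.T v) v

theorem continuous_radial : Continuous fun q : ℝ × Ell2 d => p.radial q.1 q.2 := by
  have hmul : Continuous fun q : ℝ × Ell2 d => p.mulOp (q.1 • q.2) q.2 :=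
    (p.continuous_mulOp.comp (continuous_fst.smul continuous_snd)).clm_apply continuous_snd
  unfold radial
  fun_prop

theorem strictMonoOn_radial {v : Ell2 d} (hv : v ≠ 0) :
    StrictMonoOn (fun t => p.radial t v) (Ici 0) := by
  intro s hs t ht hst
  rw [mem_Ici] at hs ht
  obtain ⟨x, hx⟩ := exists_apply_ne_zero hv
  refine sub_lt_sub_right (hasSum_lt (i := x) (fun y => ?_) ?_ (p.hasSum_mulOp (s • v) v)
    (p.hasSum_mulOp (t • v) v)) _
  · refine mul_le_mul_of_nonneg_right ?_ (sq_nonneg _)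
    simp only [lp.coeFn_smul, Pi.smul_apply, smul_eq_mul]
    rw [← p.g_abs (t * v y)]
    refine p.g_le_of_abs_le ?_
    rw [abs_mul, abs_mul, abs_of_nonneg hs, abs_of_nonneg ht]
    exact mul_le_mul_of_nonneg_right hst.le (abs_nonneg _)
  · refine mul_lt_mul_of_pos_right ?_ (by positivity)
    simp only [lp.coeFn_smul, Pi.smul_apply, smul_eq_mul]
    refine p.g_lt_of_abs_lt ?_
    rw [abs_mul, abs_mul, abs_of_nonneg hs, abs_of_nonneg ht]
    exact mul_lt_mul_of_pos_right hst (abs_pos.2 hx)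

theorem radial_zero_neg {v : Ell2 d} (hv : v ≠ 0) : p.radial 0 v < 0 := by
  have hmul : p.mulOp 0 v = 0 := by
    ext x
    simp [p.g_zero]
  rw [radial, zero_smul, hmul, inner_zero_left, zero_sub, neg_lt_zero]
  exact p.inner_T_pos hv

theorem exists_radial_pos {v : Ell2 d} (hv : v ≠ 0) : ∃ t, 0 < t ∧ 0 < p.radial t v := by
  obtain ⟨x, hx⟩ := exists_apply_ne_zero hv
  obtain ⟨R, hR, hg⟩ := p.exists_lt_g (inner ℝ (p.T v) v / v x ^ 2)
  have hx_pos : 0 < |v x| := abs_pos.2 hx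
  refine ⟨(R + 1) / |v x|, by positivity, ?_⟩
  have hpeak := hg ((R + 1) / |v x| * v x) (by
    rw [abs_mul, abs_div, abs_abs, div_mul_cancel₀ _ hx_pos.ne', abs_of_pos (by positivity)]
    linarith)
  rw [div_lt_iff₀ (by positivity)] at hpeak
  have hterm := le_hasSum (p.hasSum_mulOp (((R + 1) / |v x|) • v) v) x fun y _ =>
    mul_nonneg (p.g_nonneg _) (sq_nonneg _)
  simp only [lp.coeFn_smul, Pi.smul_apply, smul_eq_mul] at hterm
  rw [radial]
  linarith

theorem exists_radial_eq_zero {v : Ell2 d} (hv : v ≠ 0) : ∃ t, 0 < t ∧ p.radial t v = 0 := by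
  obtain ⟨t, ht, hpos⟩ := p.exists_radial_pos hv
  have hcont : ContinuousOn (fun s => p.radial s v) (Icc 0 t) :=
    (p.continuous_radial.comp (continuous_id.prodMk continuous_const)).continuousOn
  obtain ⟨s, hs, hs_zero⟩ := intermediate_value_Ioo ht.le hcont ⟨p.radial_zero_neg hv, hpos⟩
  exact ⟨s, hs.1, hs_zero⟩

open Classical in
/-- The factor `t > 0` for which `t v` lies on the Nehari set; at `v = 0` it is set to `1`. -/
def scale (v : Ell2 d) : ℝ :=
  if h : v ≠ 0 then (p.exists_radial_eq_zero h).choose else 1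

theorem scale_pos (v : Ell2 d) : 0 < p.scale v := by
  rw [scale]
  split_ifs with h
  · exact (p.exists_radial_eq_zero h).choose_spec.1
  · exact one_pos

theorem radial_scale {v : Ell2 d} (hv : v ≠ 0) : p.radial (p.scale v) v = 0 := by
  rw [scale, dif_pos hv]
  exact (p.exists_radial_eq_zero hv).choose_spec.2

theorem scale_lt_iff {v : Ell2 d} (hv : v ≠ 0) {t : ℝ} (ht : 0 ≤ t) :
    p.scale v < t ↔ 0 < p.radial t v := by
  rw [← p.radial_scale hv]
  exact ((p.strictMonoOn_radial hv).lt_iff_lt (p.scale_pos v).le ht).symm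

theorem lt_scale_iff {v : Ell2 d} (hv : v ≠ 0) {t : ℝ} (ht : 0 ≤ t) :
    t < p.scale v ↔ p.radial t v < 0 := by
  rw [← p.radial_scale hv]
  exact ((p.strictMonoOn_radial hv).lt_iff_lt ht (p.scale_pos v).le).symm

theorem scale_eq_of_radial_eq_zero {v : Ell2 d} (hv : v ≠ 0) {t : ℝ} (ht : 0 ≤ t)
    (h : p.radial t v = 0) : p.scale v = t :=
  (p.strictMonoOn_radial hv).injOn (p.scale_pos v).le ht ((p.radial_scale hv).trans h.symm)

theorem continuousAt_scale {v : Ell2 d} (hv : v ≠ 0) : ContinuousAt p.scale v := by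
  have hne : ∀ᶠ w in 𝓝 v, w ≠ 0 := isOpen_ne.mem_nhds hv
  have hcont : ∀ t, Continuous (p.radial t) := fun t =>
    p.continuous_radial.comp (continuous_const.prodMk continuous_id)
  refine tendsto_order.2 ⟨fun a ha => ?_, fun b hb => ?_⟩
  · rcases lt_or_ge a 0 with ha_neg | ha_nonneg
    · exact Eventually.of_forall fun w => ha_neg.trans (p.scale_pos w)
    · filter_upwards [hne, (hcont a).continuousAt.eventually_lt_const
        ((p.lt_scale_iff hv ha_nonneg).1 ha)] with w hw hradial
      exact (p.lt_scale_iff hw ha_nonneg).2 hradial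
  · have hb_nonneg : 0 ≤ b := (p.scale_pos v).le.trans hb.le
    filter_upwards [hne, (hcont b).continuousAt.eventually_const_lt
      ((p.scale_lt_iff hv hb_nonneg).1 hb)] with w hw hradial
    exact (p.scale_lt_iff hw hb_nonneg).2 hradial

theorem nehari_scale {v : Ell2 d} (hv : v ≠ 0) : p.Nehari (p.scale v • v) := by
  refine ⟨smul_ne_zero (p.scale_pos v).ne' hv, ?_⟩
  have hradial := p.radial_scale hv
  rw [radial, sub_eq_zero] at hradial
  simp only [map_smul, inner_smul_left, inner_smul_right, hradial]

theorem scale_neg (v : Ell2 d) : p.scale (-v) = p.scale v := by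
  by_cases hv : v = 0
  · rw [hv, neg_zero]
  refine p.scale_eq_of_radial_eq_zero (neg_ne_zero.2 hv) (p.scale_pos v).le ?_
  rw [← p.radial_scale hv, radial, radial, smul_neg, mulOp_neg]
  simp

theorem scale_eq_of_nehari {v : Ell2 d} {t : ℝ} (ht : 0 < t) (h : p.Nehari (t • v)) :
    p.scale v = t := by
  have hv : v ≠ 0 := (smul_ne_zero_iff.1 h.1).2
  refine p.scale_eq_of_radial_eq_zero hv ht.le ?_
  have hnehari := h.2
  simp only [map_smul, inner_smul_left, inner_smul_right, conj_trivial] at hnehari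
  rw [radial, sub_eq_zero]
  exact mul_left_cancel₀ ht.ne' (mul_left_cancel₀ ht.ne' hnehari)

/-! ### The fixed point iteration and its energy loss -/

theorem isCoercive_T : IsCoercive ((innerSL ℝ).comp p.T : Ell2 d →L[ℝ] Ell2 d →L[ℝ] ℝ) :=
  ⟨p.c, p.c_pos, fun u => by simpa [sq, mul_assoc] using p.T_coercive u⟩

/-- The inverse of the linear part `T`, given by the Lax–Milgram theorem. -/
def inv : Ell2 d →L[ℝ] Ell2 d := p.isCoercive_T.continuousLinearEquivOfBilin.symm

theorem T_inv (u : Ell2 d) : p.T (p.inv u) = u := by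
  refine ext_inner_right ℝ fun w => ?_
  have hweak := p.isCoercive_T.continuousLinearEquivOfBilin_apply (p.inv u) w
  rw [inv, ContinuousLinearEquiv.coe_coe, ContinuousLinearEquiv.apply_symm_apply] at hweak
  exact hweak.symm

/-- One step `u ↦ T⁻¹ (u g(u))` of the fixed point iteration for `T u = u g(u)`. -/
def iter (u : Ell2 d) : Ell2 d := p.inv (p.nonlin u)

theorem T_iter (u : Ell2 d) : p.T (p.iter u) = p.nonlin u := p.T_inv _

theorem iter_neg (u : Ell2 d) : p.iter (-u) = -p.iter u := by
  rw [iter, nonlin_neg, map_neg, iter]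

theorem continuous_iter : Continuous p.iter := p.inv.continuous.comp p.continuous_nonlin

theorem inner_mulOp_sq_le (u v w : Ell2 d) :
    inner ℝ (p.mulOp u v) w ^ 2 ≤ inner ℝ (p.mulOp u v) v * inner ℝ (p.mulOp u w) w := by
  let B : LinearMap.BilinForm ℝ (Ell2 d) := (innerₗ (Ell2 d)).comp (p.mulOp u).toLinearMap
  have hsymm : LinearMap.IsSymm B := ⟨fun v w => by
    change inner ℝ (p.mulOp u v) w = inner ℝ (p.mulOp u w) v
    rw [p.mulOp_symm, real_inner_comm]⟩
  exact B.apply_sq_le_of_symm (p.inner_mulOp_nonneg u) hsymm v w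

variable {p}

theorem Nehari.iter_ne_zero {u : Ell2 d} (hu : p.Nehari u) : p.iter u ≠ 0 := by
  intro hzero
  have hmul : p.mulOp u u = 0 := (p.T_iter u).symm.trans (by rw [hzero, map_zero])
  have hpos := p.inner_T_pos hu.1
  rw [← hu.2, hmul, inner_zero_left] at hpos
  exact lt_irrefl _ hpos

theorem Nehari.inner_T_iter_left {u : Ell2 d} (hu : p.Nehari u) :
    inner ℝ (p.T (p.iter u)) u = inner ℝ (p.T u) u := by
  rw [T_iter, nonlin, hu.2]

theorem Nehari.mul_norm_iter_sub_sq_le {u : Ell2 d} (hu : p.Nehari u) :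
    p.c * ‖p.iter u - u‖ ^ 2 ≤
      inner ℝ (p.T (p.iter u)) (p.iter u) - inner ℝ (p.T u) u := by
  have hcross : inner ℝ (p.T u) (p.iter u) = inner ℝ (p.T u) u := by
    rw [p.T_symm, real_inner_comm, hu.inner_T_iter_left]
  have hcoercive := p.T_coercive (p.iter u - u)
  simp only [map_sub, inner_sub_left, inner_sub_right, hcross, hu.inner_T_iter_left] at hcoercive
  linarith

theorem Nehari.inner_T_iter_sq_le {u : Ell2 d} (hu : p.Nehari u) :
    inner ℝ (p.T (p.iter u)) (p.iter u) ^ 2 ≤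
      inner ℝ (p.T u) u * inner ℝ (p.mulOp u (p.iter u)) (p.iter u) := by
  have hcs := p.inner_mulOp_sq_le u u (p.iter u)
  rwa [hu.2, ← nonlin, ← T_iter] at hcs

theorem Nehari.action_smul_iter_le {u : Ell2 d} (hu : p.Nehari u) (t : ℝ) :
    p.action (t • p.iter u) + inner ℝ (p.T (t • p.iter u)) (t • p.iter u) / 2 *
      (p.c * ‖p.iter u - u‖ ^ 2 / inner ℝ (p.T u) u) ≤ p.action u := by
  have ha := p.inner_T_pos hu.1
  have hdefect := hu.mul_norm_iter_sub_sq_le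
  have hcs := hu.inner_T_iter_sq_le
  have haction := hu.action_le (t • p.iter u)
  have hb := p.inner_T_pos hu.iter_ne_zero
  simp only [map_smul, inner_smul_left, inner_smul_right, conj_trivial] at haction ⊢
  set a := inner ℝ (p.T u) u
  set b := inner ℝ (p.T (p.iter u)) (p.iter u)
  set q := inner ℝ (p.mulOp u (p.iter u)) (p.iter u)
  have hloss : b * (p.c * ‖p.iter u - u‖ ^ 2 / a) ≤ q - b :=
    calc b * (p.c * ‖p.iter u - u‖ ^ 2 / a) ≤ b * ((b - a) / a) := by gcongr
      _ = b ^ 2 / a - b := by field_simp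
      _ ≤ q - b := by
        rw [sub_le_sub_iff_right, div_le_iff₀' ha]
        exact hcs
  nlinarith [mul_le_mul_of_nonneg_left hloss (mul_self_nonneg t)]

end Problem

/-- The unit sphere of `ℓ²`. -/
abbrev UnitSphere (d : ℕ) : Type := Metric.sphere (0 : Ell2 d) 1

theorem norm_normalize_sub_le {E : Type*} [NormedAddCommGroup E] [NormedSpace ℝ E] {x : E}
    (hx : x ≠ 0) (y : E) :
    ‖NormedSpace.normalize y - NormedSpace.normalize x‖ ≤ 2 * (‖y - x‖ / ‖x‖) := by
  have hsplit : ‖x‖ • (NormedSpace.normalize y - NormedSpace.normalize x) =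
      (‖x‖ - ‖y‖) • NormedSpace.normalize y + (y - x) := by
    rw [smul_sub, sub_smul, NormedSpace.norm_smul_normalize, NormedSpace.norm_smul_normalize]
    abel
  have hy : ‖NormedSpace.normalize y‖ ≤ 1 := by
    obtain rfl | h := eq_or_ne y 0
    · rw [NormedSpace.normalize_zero_eq_zero, norm_zero]
      exact zero_le_one
    · exact (NormedSpace.norm_normalize h).le
  rw [← mul_div_assoc, le_div_iff₀' (norm_pos_iff.2 hx)]
  calc ‖x‖ * ‖NormedSpace.normalize y - NormedSpace.normalize x‖
    _ = ‖(‖x‖ - ‖y‖) • NormedSpace.normalize y + (y - x)‖ := by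
        rw [← hsplit, norm_smul, norm_norm]
    _ ≤ |‖x‖ - ‖y‖| * ‖NormedSpace.normalize y‖ + ‖y - x‖ := by
        rw [← Real.norm_eq_abs, ← norm_smul]
        exact norm_add_le _ _
    _ ≤ ‖y - x‖ * 1 + ‖y - x‖ := by
        gcongr
        rw [norm_sub_rev]
        exact abs_norm_sub_norm_le x y
    _ = 2 * ‖y - x‖ := by ring

namespace Problem

variable (p : Problem d)

/-- The point of the Nehari set on the ray through a point of the sphere. -/
def lift (v : UnitSphere d) : Ell2 d := p.scale v • (v : Ell2 d)

theorem nehari_lift (v : UnitSphere d) : p.Nehari (p.lift v) :=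
  p.nehari_scale (ne_zero_of_mem_unit_sphere v)

theorem norm_lift (v : UnitSphere d) : ‖p.lift v‖ = p.scale v := by
  rw [lift, norm_smul, norm_eq_of_mem_sphere v, mul_one, Real.norm_of_nonneg (p.scale_pos _).le]

theorem normalize_lift (v : UnitSphere d) : NormedSpace.normalize (p.lift v) = v := by
  rw [lift, NormedSpace.normalize_smul_of_pos (p.scale_pos _),
    NormedSpace.normalize_eq_self_of_norm_eq_one (norm_eq_of_mem_sphere v)]

theorem continuous_lift : Continuous p.lift := by
  have hscale : Continuous fun v : UnitSphere d => p.scale v :=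
    continuous_iff_continuousAt.2 fun v => (p.continuousAt_scale
      (ne_zero_of_mem_unit_sphere v)).comp continuous_subtype_val.continuousAt
  exact hscale.smul continuous_subtype_val

theorem lift_neg (v : UnitSphere d) : p.lift (-v) = -p.lift v := by
  simp [lift, scale_neg]

/-- The action on the Nehari set, as a function on the sphere; it is the maximum of the action
along the ray. -/
def reduced (v : UnitSphere d) : ℝ := p.action (p.lift v)

/-- The fixed point iteration on the Nehari set, as a self-map of the sphere. -/
def descend (v : UnitSphere d) : UnitSphere d :=
  ⟨NormedSpace.normalize (p.iter (p.lift v)), by simpa using (p.nehari_lift v).iter_ne_zero⟩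

theorem continuous_descend : Continuous p.descend := by
  have hiter : Continuous fun v => p.iter (p.lift v) := p.continuous_iter.comp p.continuous_lift
  exact Continuous.subtype_mk ((hiter.norm.inv₀ fun v =>
    norm_ne_zero_iff.2 (p.nehari_lift v).iter_ne_zero).smul hiter) _

theorem descend_neg (v : UnitSphere d) : p.descend (-v) = -p.descend v := by
  ext1
  simp [descend, lift_neg, iter_neg]

theorem exists_descent_rate : ∃ r, 0 < r ∧ ∀ v : UnitSphere d,
    r * (‖p.iter (p.lift v) - p.lift v‖ / ‖p.lift v‖) ^ 2 ≤
      p.reduced v - p.reduced (p.descend v) := by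
  obtain ⟨ρ, hρ, hnehari⟩ := p.exists_le_norm_of_nehari
  have hc := p.c_pos
  refine ⟨p.c * ρ ^ 2 / 2 * (p.c / (‖p.T‖ + 1)), by positivity, fun v => ?_⟩
  have hu : p.Nehari (p.lift v) := p.nehari_lift v
  have hlift : p.lift (p.descend v) =
      (p.scale (p.descend v) * ‖p.iter (p.lift v)‖⁻¹) • p.iter (p.lift v) := by
    exact smul_smul (p.scale (p.descend v)) _ (p.iter (p.lift v))
  have hloss := hu.action_smul_iter_le (p.scale (p.descend v) * ‖p.iter (p.lift v)‖⁻¹)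
  rw [← hlift] at hloss
  simp only [reduced]
  set u := p.lift v
  set w := p.lift (p.descend v)
  have hw : p.c * ρ ^ 2 ≤ inner ℝ (p.T w) w := by
    refine le_trans ?_ (p.T_coercive w)
    gcongr
    exact hnehari w (p.nehari_lift _)
  have hu_pos : 0 < inner ℝ (p.T u) u := p.inner_T_pos hu.1
  have hTu : inner ℝ (p.T u) u ≤ (‖p.T‖ + 1) * ‖u‖ ^ 2 := by
    nlinarith [p.inner_T_le u, sq_nonneg ‖u‖]
  have hu_norm : 0 < ‖u‖ := norm_pos_iff.2 hu.1
  have hrate : p.c * ρ ^ 2 / 2 * (p.c / (‖p.T‖ + 1)) * (‖p.iter u - u‖ / ‖u‖) ^ 2 ≤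
      inner ℝ (p.T w) w / 2 * (p.c * ‖p.iter u - u‖ ^ 2 / inner ℝ (p.T u) u) :=
    calc p.c * ρ ^ 2 / 2 * (p.c / (‖p.T‖ + 1)) * (‖p.iter u - u‖ / ‖u‖) ^ 2
      _ = p.c * ρ ^ 2 / 2 * (p.c * ‖p.iter u - u‖ ^ 2 / ((‖p.T‖ + 1) * ‖u‖ ^ 2)) := by
        have : 0 < ‖p.T‖ + 1 := by positivity
        field_simp
      _ ≤ _ := by
        have : 0 ≤ inner ℝ (p.T w) w / 2 := by linarith [mul_pos hc (pow_pos hρ 2)]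
        gcongr
  linarith

end Problem

/-! ### Bounded sequences and translation orbits in `ℓ²` -/

theorem tendsto_inner_of_tendsto_pointwise {v : ℕ → Ell2 d} {w : Ell2 d} {C : ℝ}
    (hv : ∀ n, ‖v n‖ ≤ C) (hvw : ∀ x, Tendsto (fun n => v n x) atTop (𝓝 (w x))) (a : Ell2 d) :
    Tendsto (fun n => inner ℝ a (v n)) atTop (𝓝 (inner ℝ a w)) := by
  classical
  have hC : 0 ≤ C := (norm_nonneg _).trans (hv 0)
  have hsum : Tendsto (fun s => ∑ x ∈ s, (lp.single 2 x (a x) : Ell2 d)) atTop (𝓝 a) :=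
    lp.hasSum_single (E := fun _ : Lattice d => ℝ) (p := 2) (by norm_num) a
  have hunif : TendstoUniformly
      (fun s n => inner ℝ (∑ x ∈ s, (lp.single 2 x (a x) : Ell2 d)) (v n))
      (fun n => inner ℝ a (v n)) atTop := by
    refine Metric.tendstoUniformly_iff.2 fun ε hε => ?_
    filter_upwards [Metric.tendsto_nhds.1 hsum (ε / (C + 1)) (by positivity)] with s hs n
    rw [Real.dist_eq, ← inner_sub_left]
    calc _ ≤ _ := abs_real_inner_le_norm _ _
      _ ≤ ε / (C + 1) * C := by
        rw [← dist_eq_norm, dist_comm]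
        exact mul_le_mul hs.le (hv n) (norm_nonneg _) (by positivity)
      _ < ε := by
        rw [div_mul_eq_mul_div, div_lt_iff₀ (by positivity)]
        linarith
  refine hunif.tendsto_of_eventually_tendsto (Eventually.of_forall fun s => ?_)
    (hsum.inner tendsto_const_nhds)
  simp only [sum_inner, lp.inner_single_left]
  exact tendsto_finsetSum _ fun x _ => tendsto_const_nhds.inner (hvw x)

theorem norm_le_of_tendsto_pointwise {v : ℕ → Ell2 d} {w : Ell2 d} {C : ℝ}
    (hv : ∀ n, ‖v n‖ ≤ C) (hvw : ∀ x, Tendsto (fun n => v n x) atTop (𝓝 (w x))) : ‖w‖ ≤ C :=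
  lp.norm_le_of_tendsto (E := fun _ : Lattice d => ℝ) (p := 2)
    (Eventually.of_forall hv) (tendsto_pi_nhds.2 hvw)

theorem exists_subseq_tendsto_pointwise {v : ℕ → Ell2 d} {C : ℝ} (hv : ∀ n, ‖v n‖ ≤ C) :
    ∃ (φ : ℕ → ℕ) (w : Ell2 d), StrictMono φ ∧
      ∀ x, Tendsto (fun n => v (φ n) x) atTop (𝓝 (w x)) := by
  have hcompact : IsCompact (univ.pi fun _ : Lattice d => Icc (-C) C) :=
    isCompact_univ_pi fun _ => isCompact_Icc
  obtain ⟨w, -, φ, hφ, hlim⟩ := hcompact.tendsto_subseq (x := fun n => ⇑(v n)) fun n x _ =>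
    abs_le.1 ((abs_apply_le_norm _ x).trans (hv n))
  have hbounded : Bornology.IsBounded (range (v ∘ φ)) :=
    isBounded_iff_forall_norm_le.2 ⟨C, forall_mem_range.2 fun n => hv (φ n)⟩
  exact ⟨φ, ⟨w, lp.memℓp_of_tendsto (E := fun _ : Lattice d => ℝ) (p := 2) hbounded hlim⟩, hφ,
    tendsto_pi_nhds.1 hlim⟩

theorem finite_setOf_le_abs (u : Ell2 d) {a : ℝ} (ha : 0 < a) : {x | a ≤ |u x|}.Finite := by
  have hlim : Tendsto (fun x => ‖u x‖ ^ (2 : ℝ)) cofinite (𝓝 0) :=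
    ((lp.memℓp u).summable (by norm_num)).tendsto_cofinite_zero
  refine (hlim.eventually (gt_mem_nhds (Real.rpow_pos_of_pos ha 2))).subset fun x hx => ?_
  exact not_lt.2 (Real.rpow_le_rpow ha.le hx zero_le_two)

theorem exists_separation_shift (q r : Ell2 d) :
    ∃ κ, 0 < κ ∧ ∀ y, q ≠ shift y r → κ ≤ ‖q - shift y r‖ := by
  obtain rfl | hq := eq_or_ne q 0
  · obtain rfl | hr := eq_or_ne r 0
    · exact ⟨1, one_pos, fun y hy => absurd (map_zero (shift y)).symm hy⟩
    · refine ⟨‖r‖, norm_pos_iff.2 hr, fun y _ => ?_⟩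
      rw [zero_sub, norm_neg, LinearIsometry.norm_map]
  obtain ⟨x, hx⟩ := exists_apply_ne_zero hq
  have hpeak : 0 < |q x| := abs_pos.2 hx
  -- Outside a finite set of translations, `shift y r` is small where `q` is not.
  have hfinite : {y | |q x| / 2 ≤ |r (x - y)|}.Finite :=
    Finite.preimage (f := fun y => x - y) sub_right_injective.injOn
      (finite_setOf_le_abs r (half_pos hpeak))
  obtain ⟨κ, hκ, hnear⟩ := exists_pos_forall_of_finite hfinite
    (P := fun κ y => q ≠ shift y r → κ ≤ ‖q - shift y r‖)
    (fun y κ κ' hle hκ' hne => hle.trans (hκ' hne)) fun y _ => by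
      by_cases hy : q = shift y r
      · exact ⟨1, one_pos, fun hne => absurd hy hne⟩
      · exact ⟨‖q - shift y r‖, norm_pos_iff.2 (sub_ne_zero.2 hy), fun _ => le_rfl⟩
  refine ⟨min κ (|q x| / 2), by positivity, fun y hne => ?_⟩
  by_cases hy : |q x| / 2 ≤ |r (x - y)|
  · exact (min_le_left _ _).trans (hnear y hy hne)
  · refine (min_le_right _ _).trans ?_
    calc |q x| / 2 ≤ |q x| - |r (x - y)| := by linarith
      _ ≤ |(q - shift y r) x| := abs_sub_abs_le_abs_sub _ _
      _ ≤ ‖q - shift y r‖ := abs_apply_le_norm _ x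

theorem shift_shift (y z : Lattice d) (u : Ell2 d) : shift y (shift z u) = shift (y + z) u := by
  ext x
  simp [sub_sub]

theorem exists_separation_orbits (F : Finset (Ell2 d)) :
    ∃ κ, 0 < κ ∧ {u | ∃ q ∈ F, ∃ y, u = shift y q}.Pairwise fun u w => κ ≤ ‖u - w‖ := by
  obtain ⟨κ, hκ, hsep⟩ := exists_pos_forall_of_finite (F ×ˢ F).finite_toSet
    (P := fun κ (i : Ell2 d × Ell2 d) => ∀ y, i.1 ≠ shift y i.2 → κ ≤ ‖i.1 - shift y i.2‖)
    (fun i κ κ' hle hκ' y hne => hle.trans (hκ' y hne)) fun i _ => exists_separation_shift i.1 i.2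
  refine ⟨κ, hκ, ?_⟩
  rintro _ ⟨q, hq, y, rfl⟩ _ ⟨r, hr, z, rfl⟩ hne
  have hz : shift z r = shift y (shift (z - y) r) := by rw [shift_shift, add_sub_cancel]
  rw [hz] at hne
  rw [hz, ← map_sub, LinearIsometry.norm_map]
  exact hsep (q, r) (Finset.mem_product.2 ⟨hq, hr⟩) (z - y) fun heq => hne (congrArg (shift y) heq)

namespace Problem

variable (p : Problem d)

/-! ### Clusters of almost critical points -/

/-- The defect `T u - u g(u)` of the equation. -/
def defect (u : Ell2 d) : Ell2 d := p.T u - p.nonlin u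

/-- The nontrivial solutions of `T u = u g(u)`, i.e. the nontrivial critical points of the
action. -/
def criticalSet : Set (Ell2 d) := {u | u ≠ 0 ∧ p.defect u = 0}

theorem defect_shift (y : Lattice d) (u : Ell2 d) :
    p.defect (shift y u) = shift y (p.defect u) := by
  rw [defect, p.T_shift, p.nonlin_shift, ← map_sub, defect]

variable {p} in
theorem nehari_of_mem_criticalSet {u : Ell2 d} (hu : u ∈ p.criticalSet) : p.Nehari u := by
  refine ⟨hu.1, ?_⟩
  rw [← nonlin, ← sub_eq_zero.1 hu.2]

theorem exists_inner_mulOp_le (R : ℝ) : ∃ K, 0 ≤ K ∧ ∀ (u y : Ell2 d) (δ : ℝ), ‖u‖ ≤ R →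
    (∀ x, |y x| ≤ δ) → inner ℝ (p.mulOp u y) y ≤ p.c / 2 * ‖y‖ ^ 2 + K * δ ^ 2 := by
  obtain ⟨ρ, hρ, hg⟩ := p.exists_g_le (half_pos p.c_pos)
  have hc := p.c_pos
  have hgR := p.g_nonneg R
  refine ⟨p.g R / ρ ^ 2 * R ^ 2, by positivity, fun u y δ hu hy => ?_⟩
  -- Where `|u x| ≤ ρ` the weight `g (u x)` is at most `c / 2`; elsewhere `1 ≤ (u x / ρ) ^ 2`.
  have hpointwise : ∀ x, p.g (u x) * y x ^ 2 ≤
      p.c / 2 * (y x * y x) + p.g R / ρ ^ 2 * δ ^ 2 * (u x * u x) := by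
    intro x
    have hfirst : 0 ≤ p.c / 2 * (y x * y x) := mul_nonneg (by positivity) (mul_self_nonneg _)
    have hsecond : 0 ≤ p.g R / ρ ^ 2 * δ ^ 2 * (u x * u x) :=
      mul_nonneg (by positivity) (mul_self_nonneg _)
    obtain hx | hx := le_total |u x| ρ
    · rw [sq]
      linarith [mul_le_mul_of_nonneg_right (hg (u x) hx) (mul_self_nonneg (y x))]
    · have hu_sq : 1 ≤ u x ^ 2 / ρ ^ 2 := by
        rw [one_le_div (by positivity), ← sq_abs (u x)]
        gcongr
      have hy_sq : y x ^ 2 ≤ δ ^ 2 := sq_le_sq' (abs_le.1 (hy x)).1 (abs_le.1 (hy x)).2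
      have hgu : p.g (u x) ≤ p.g R := p.g_le_of_abs_le ((abs_apply_le_norm u x).trans hu)
      calc p.g (u x) * y x ^ 2 ≤ p.g R * δ ^ 2 := by gcongr
        _ ≤ p.g R * δ ^ 2 * (u x ^ 2 / ρ ^ 2) := le_mul_of_one_le_right (by positivity) hu_sq
        _ = p.g R / ρ ^ 2 * δ ^ 2 * (u x * u x) := by ring
        _ ≤ _ := le_add_of_nonneg_left hfirst
  have hsum := hasSum_le hpointwise (p.hasSum_mulOp u y) (((hasSum_inner_mul y y).mul_left _).add
    ((hasSum_inner_mul u u).mul_left _))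
  rw [real_inner_self_eq_norm_sq, real_inner_self_eq_norm_sq] at hsum
  calc _ ≤ _ := hsum
    _ ≤ p.c / 2 * ‖y‖ ^ 2 + p.g R / ρ ^ 2 * δ ^ 2 * R ^ 2 := by gcongr
    _ = _ := by ring

theorem half_mul_norm_sub_sq_le {u w : Ell2 d} {K R δ η : ℝ} (hw : ‖w‖ ≤ R)
    (hsub : ‖u - w‖ ≤ 2 * R) (hdu : ‖p.defect u‖ ≤ δ) (hdw : ‖p.defect w‖ ≤ δ)
    (hmul : ‖p.mulOp u - p.mulOp w‖ ≤ η)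
    (hquad : inner ℝ (p.mulOp u (u - w)) (u - w) ≤ p.c / 2 * ‖u - w‖ ^ 2 + K * δ ^ 2) :
    p.c / 2 * ‖u - w‖ ^ 2 ≤ (2 * δ + η * R) * (2 * R) + K * δ ^ 2 := by
  have hη : 0 ≤ η := (norm_nonneg _).trans hmul
  have hT : p.T (u - w) =
      p.defect u - p.defect w + (p.mulOp u - p.mulOp w) w + p.mulOp u (u - w) := by
    simp only [map_sub, defect, nonlin, sub_apply]
    abel
  have hsource : ‖p.defect u - p.defect w + (p.mulOp u - p.mulOp w) w‖ ≤ 2 * δ + η * R :=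
    calc _ ≤ ‖p.defect u‖ + ‖p.defect w‖ + ‖p.mulOp u - p.mulOp w‖ * ‖w‖ :=
        (norm_add_le _ _).trans (add_le_add (norm_sub_le _ _) (ContinuousLinearMap.le_opNorm _ _))
      _ ≤ δ + δ + η * R := by gcongr
      _ = 2 * δ + η * R := by ring
  have hsource_inner := (real_inner_le_norm (p.defect u - p.defect w + (p.mulOp u - p.mulOp w) w)
    (u - w)).trans (mul_le_mul hsource hsub (norm_nonneg _) ((norm_nonneg _).trans hsource))
  have hcoercive := p.T_coercive (u - w)
  rw [hT, inner_add_left] at hcoercive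
  linarith

theorem exists_norm_sub_lt {R : ℝ} (hR : 0 < R) {ε : ℝ} (hε : 0 < ε) : ∃ δ, 0 < δ ∧ ∀ u w,
    ‖u‖ ≤ R → ‖w‖ ≤ R → ‖p.defect u‖ ≤ δ → ‖p.defect w‖ ≤ δ → (∀ x, |u x - w x| ≤ δ) →
      ‖u - w‖ < ε := by
  have hc := p.c_pos
  obtain ⟨K, -, hquad⟩ := p.exists_inner_mulOp_le R
  set A := p.c / 2 * ε ^ 2
  have hA : 0 < A := by positivity
  obtain ⟨δ₁, hδ₁, hg⟩ := p.exists_g_sub_lt R (show 0 < A / (4 * R ^ 2) by positivity)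
  have herror : ∀ᶠ δ in 𝓝[>] (0 : ℝ), 4 * R * δ + K * δ ^ 2 < A / 2 := by
    have hcont : Continuous fun δ : ℝ => 4 * R * δ + K * δ ^ 2 := by fun_prop
    exact nhdsWithin_le_nhds ((hcont.tendsto' 0 0 (by simp)).eventually_lt_const (half_pos hA))
  obtain ⟨δ, hδA, hδ, hδδ₁⟩ := (herror.and (Ioo_mem_nhdsGT hδ₁)).exists
  refine ⟨δ, hδ, fun u w hu hw hdu hdw hclose => ?_⟩
  have hmul : ‖p.mulOp u - p.mulOp w‖ ≤ A / (4 * R ^ 2) :=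
    p.norm_mulOp_sub_le (by positivity) fun x => (hg _ _ ((abs_apply_le_norm u x).trans hu)
      ((abs_apply_le_norm w x).trans hw) ((hclose x).trans_lt hδδ₁)).le
  have hbound := p.half_mul_norm_sub_sq_le hw (by linarith [norm_sub_le u w]) hdu hdw hmul
    (hquad u (u - w) δ hu hclose)
  have hη : A / (4 * R ^ 2) * R * (2 * R) = A / 2 := by
    field_simp
    norm_num
  have hsq : p.c / 2 * ‖u - w‖ ^ 2 < p.c / 2 * ε ^ 2 := by
    refine lt_of_le_of_lt hbound ?_
    change _ < A
    linarith
  exact lt_of_pow_lt_pow_left₀ 2 hε.le (lt_of_mul_lt_mul_left hsq (by positivity))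

theorem exists_defect_le (D : ℝ) {η : ℝ} (hη : 0 < η) : ∃ δ, 0 < δ ∧ ∀ v : UnitSphere d,
    p.reduced v ≤ D → p.reduced v - p.reduced (p.descend v) ≤ δ → ‖p.defect (p.lift v)‖ ≤ η := by
  obtain ⟨r, hr, hdescent⟩ := p.exists_descent_rate
  obtain ⟨R, hR, hbound⟩ := p.exists_norm_le_of_nehari D
  set σ := η / ((‖p.T‖ + 1) * R) with hσ
  have hσ_pos : 0 < σ := by positivity
  refine ⟨r * σ ^ 2, by positivity, fun v hvD hv => ?_⟩
  have hu := p.nehari_lift v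
  have hdescent_v := (hdescent v).trans hv
  set u := p.lift v
  have hstep : ‖p.iter u - u‖ ≤ σ * ‖u‖ := by
    rw [← div_le_iff₀ (norm_pos_iff.2 hu.1)]
    exact le_of_sq_le_sq (le_of_mul_le_mul_left hdescent_v hr) hσ_pos.le
  have hdefect : p.defect u = -p.T (p.iter u - u) := by
    rw [map_sub, p.T_iter, defect, neg_sub]
  rw [hdefect, norm_neg]
  calc ‖p.T (p.iter u - u)‖ ≤ ‖p.T‖ * ‖p.iter u - u‖ := p.T.le_opNorm _
    _ ≤ (‖p.T‖ + 1) * (σ * R) := by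
      gcongr
      · exact le_add_of_nonneg_right zero_le_one
      · exact hstep.trans (by gcongr; exact hbound u hu hvD)
    _ = η := by rw [hσ]; field_simp

theorem defect_eq_zero_of_tendsto {u : ℕ → Ell2 d} {w : Ell2 d} {C : ℝ} (hu : ∀ n, ‖u n‖ ≤ C)
    (huw : ∀ x, Tendsto (fun n => u n x) atTop (𝓝 (w x)))
    (hdefect : Tendsto (fun n => ‖p.defect (u n)‖) atTop (𝓝 0)) : p.defect w = 0 := by
  classical
  ext x
  have hlim : Tendsto (fun n => p.defect (u n) x) atTop (𝓝 0) :=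
    squeeze_zero_norm (fun n => abs_apply_le_norm _ x) hdefect
  refine tendsto_nhds_unique ?_ hlim
  have hT : ∀ z : Ell2 d, p.T z x = inner ℝ (p.T (lp.single 2 x (1 : ℝ))) z := by
    intro z
    rw [p.T_symm, lp.inner_single_left]
    simp
  simp only [defect, lp.coeFn_sub, Pi.sub_apply, nonlin_apply, hT]
  exact (tendsto_inner_of_tendsto_pointwise hu huw _).sub
    (((p.g_continuous.tendsto _).comp (huw x)).mul (huw x))

variable {p}

theorem eq_of_normalize_eq {u w : Ell2 d} (hu : p.Nehari u) (hw : p.Nehari w)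
    (h : NormedSpace.normalize u = NormedSpace.normalize w) : u = w := by
  have hscale : ∀ z, p.Nehari z →
      p.scale (NormedSpace.normalize z) • NormedSpace.normalize z = z := by
    intro z hz
    rw [p.scale_eq_of_nehari (norm_pos_iff.2 hz.1) (by rwa [NormedSpace.norm_smul_normalize]),
      NormedSpace.norm_smul_normalize]
  rw [← hscale u hu, ← hscale w hw, h]

theorem min_mul_norm_le {κ : ℝ} {v w : Ell2 d} {a b : ℝ} (hsep : p.criticalSet.Pairwise
      fun u w => κ ≤ ‖NormedSpace.normalize u - NormedSpace.normalize w‖)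
    (ha : 0 < a) (hb : 0 < b) (hv : a • v ∈ p.criticalSet) (hw : p.defect (b • w) = 0)
    (hne : a • v ≠ b • w) : min κ 1 * ‖v‖ ≤ 2 * ‖v - w‖ := by
  have hv_ne : v ≠ 0 := (smul_ne_zero_iff.1 hv.1).2
  obtain rfl | hw_ne := eq_or_ne w 0
  · rw [sub_zero]
    exact mul_le_mul_of_nonneg_right (by linarith [min_le_right κ 1]) (norm_nonneg _)
  · have hgap : κ ≤ ‖NormedSpace.normalize (a • v) - NormedSpace.normalize (b • w)‖ :=
      hsep hv ⟨smul_ne_zero hb.ne' hw_ne, hw⟩ hne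
    rw [NormedSpace.normalize_smul_of_pos ha, NormedSpace.normalize_smul_of_pos hb,
      norm_sub_rev] at hgap
    have hquot := hgap.trans (norm_normalize_sub_le hv_ne w)
    rw [← mul_div_assoc, le_div_iff₀ (norm_pos_iff.2 hv_ne), norm_sub_rev] at hquot
    exact (mul_le_mul_of_nonneg_right (min_le_left κ 1) (norm_nonneg _)).trans hquot

variable (p)

theorem exists_subseq_critical {v : ℕ → UnitSphere d} {R : ℝ} (hR : ∀ n, ‖p.lift (v n)‖ ≤ R)
    (hdefect : Tendsto (fun n => ‖p.defect (p.lift (v n))‖) atTop (𝓝 0)) (x : ℕ → Lattice d) :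
    ∃ (φ : ℕ → ℕ) (a : ℝ) (v' : Ell2 d), StrictMono φ ∧ a ∈ Ioc 0 R ∧ p.defect (a • v') = 0 ∧
      (∀ y, Tendsto (fun n => shift (x (φ n)) (v (φ n) : Ell2 d) y) atTop (𝓝 (v' y))) ∧
      ∀ y, Tendsto (fun n => shift (x (φ n)) (p.lift (v (φ n))) y) atTop (𝓝 ((a • v') y)) := by
  obtain ⟨ρ, hρ, hnehari⟩ := p.exists_le_norm_of_nehari
  have hscale : ∀ n, p.scale (v n) ∈ Icc ρ R := fun n => by
    rw [← p.norm_lift]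
    exact ⟨hnehari _ (p.nehari_lift _), hR n⟩
  obtain ⟨φ, v', hφ, hv'⟩ := exists_subseq_tendsto_pointwise
    (v := fun n => shift (x n) (v n : Ell2 d)) (C := 1) fun n => by
      rw [LinearIsometry.norm_map, norm_eq_of_mem_sphere]
  obtain ⟨a, ha, ψ, hψ, hψa⟩ := isCompact_Icc.tendsto_subseq fun n => hscale (φ n)
  have hv'ψ := fun y => (hv' y).comp hψ.tendsto_atTop
  have hlift : ∀ y, Tendsto (fun n => shift (x (φ (ψ n))) (p.lift (v (φ (ψ n)))) y) atTop
      (𝓝 ((a • v') y)) := fun y => hψa.mul (hv'ψ y)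
  refine ⟨φ ∘ ψ, a, v', hφ.comp hψ, ⟨hρ.trans_le ha.1, ha.2⟩,
    p.defect_eq_zero_of_tendsto (C := R) (fun n => ?_) hlift ?_, hv'ψ, hlift⟩
  · rw [LinearIsometry.norm_map]
    exact hR _
  · simp only [defect_shift, LinearIsometry.norm_map]
    exact hdefect.comp (hφ.comp hψ).tendsto_atTop

theorem mul_le_norm_sub_of_critical {κ ρ R : ℝ} (hκ : 0 < κ)
    (hsep : p.criticalSet.Pairwise
      fun u w => κ ≤ ‖NormedSpace.normalize u - NormedSpace.normalize w‖)
    (hR : 0 < R) (hnehari : ∀ u, p.Nehari u → ρ ≤ ‖u‖) {v w : Ell2 d} {a b : ℝ}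
    (ha : a ∈ Ioc 0 R) (hb : b ∈ Ioc 0 R) (hv : p.defect (a • v) = 0) (hw : p.defect (b • w) = 0)
    (hne : a • v ≠ b • w) : min κ 1 * (ρ / R) ≤ 2 * ‖v - w‖ := by
  wlog hv_ne : a • v ≠ 0 generalizing v w a b
  · rw [norm_sub_rev]
    exact this hb ha hw hv hne.symm fun hzero => hne ((not_not.1 hv_ne).trans hzero.symm)
  have hcritical : a • v ∈ p.criticalSet := ⟨hv_ne, hv⟩
  refine le_trans ?_ (min_mul_norm_le hsep ha.1 hb.1 hcritical hw hne)
  have hnorm : ρ ≤ a * ‖v‖ := by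
    simpa [norm_smul, abs_of_pos ha.1] using hnehari _ (nehari_of_mem_criticalSet hcritical)
  gcongr
  rw [div_le_iff₀ hR, mul_comm]
  exact hnorm.trans (mul_le_mul_of_nonneg_right ha.2 (norm_nonneg _))

theorem exists_lt_dist_of_lt_abs_sub {κ R δ : ℝ} (hδ : 0 < δ)
    (hgap : ∀ (v w : Ell2 d) (a b : ℝ), a ∈ Ioc 0 R → b ∈ Ioc 0 R → p.defect (a • v) = 0 →
      p.defect (b • w) = 0 → a • v ≠ b • w → κ < ‖v - w‖) :
    ∃ η, 0 < η ∧ ∀ v w : UnitSphere d, ‖p.lift v‖ ≤ R → ‖p.lift w‖ ≤ R →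
      ‖p.defect (p.lift v)‖ ≤ η → ‖p.defect (p.lift w)‖ ≤ η →
      (∃ x, δ < |p.lift v x - p.lift w x|) → κ < dist v w := by
  by_contra! hcon
  -- Recentre at the points where the two functions differ, so that their limits differ at `0`.
  choose v w hvR hwR hv hw hdiff hvw using
    fun n : ℕ => hcon (1 / (n + 1)) Nat.one_div_pos_of_nat
  choose x hx using hdiff
  have hsqueeze : ∀ z : ℕ → UnitSphere d, (∀ n : ℕ, ‖p.defect (p.lift (z n))‖ ≤ 1 / (n + 1)) →
      Tendsto (fun n => ‖p.defect (p.lift (z n))‖) atTop (𝓝 0) := fun z hz =>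
    squeeze_zero (fun n => norm_nonneg _) hz tendsto_one_div_add_atTop_nhds_zero_nat
  obtain ⟨φ, a, v', hφ, ha, hav, hv', hlift_v⟩ :=
    p.exists_subseq_critical hvR (hsqueeze v hv) fun n => -x n
  obtain ⟨ψ, b, w', hψ, hb, hbw, hw', hlift_w⟩ := p.exists_subseq_critical
    (fun n => hwR (φ n)) ((hsqueeze w hw).comp hφ.tendsto_atTop) fun n => -x (φ n)
  have hne : a • v' ≠ b • w' := by
    intro heq
    have hlim := (((hlift_v 0).comp hψ.tendsto_atTop).sub (hlift_w 0)).abs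
    rw [heq, sub_self, abs_zero] at hlim
    refine hδ.not_ge (ge_of_tendsto' hlim fun n => ?_)
    simpa using (hx (φ (ψ n))).le
  refine (hgap v' w' a b ha hb hav hbw hne).not_ge ?_
  refine norm_le_of_tendsto_pointwise
    (v := fun n => shift (-x (φ (ψ n))) ((v (φ (ψ n)) : Ell2 d) - w (φ (ψ n))))
    (fun n => ?_) fun y => ?_
  · rw [LinearIsometry.norm_map, ← dist_eq_norm]
    exact hvw _
  · simp only [map_sub]
    exact ((hv' y).comp hψ.tendsto_atTop).sub (hw' y)

theorem exists_dist_lt_or_lt_abs_sub {R : ℝ} (hR : 0 < R) {ε : ℝ} (hε : 0 < ε) :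
    ∃ δ, 0 < δ ∧ ∀ v w : UnitSphere d, ‖p.lift v‖ ≤ R → ‖p.lift w‖ ≤ R →
      ‖p.defect (p.lift v)‖ ≤ δ → ‖p.defect (p.lift w)‖ ≤ δ →
      dist v w < ε ∨ ∃ x, δ < |p.lift v x - p.lift w x| := by
  obtain ⟨ρ, hρ, hnehari⟩ := p.exists_le_norm_of_nehari
  obtain ⟨δ, hδ, hclose⟩ := p.exists_norm_sub_lt hR (ε := ε * ρ / 2) (by positivity)
  refine ⟨δ, hδ, fun v w hvR hwR hv hw => or_iff_not_imp_right.2 fun hx => ?_⟩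
  have hnorm : ρ ≤ ‖p.lift w‖ := hnehari _ (p.nehari_lift w)
  have hlift := hclose _ _ hvR hwR hv hw (by simpa using hx)
  have hdist := norm_normalize_sub_le (p.nehari_lift w).1 (p.lift v)
  rw [p.normalize_lift, p.normalize_lift, ← dist_eq_norm, ← Subtype.dist_eq] at hdist
  calc dist v w ≤ 2 * (‖p.lift v - p.lift w‖ / ‖p.lift w‖) := hdist
    _ ≤ 2 * (‖p.lift v - p.lift w‖ / ρ) := by gcongr
    _ < 2 * (ε * ρ / 2 / ρ) := by gcongr
    _ = ε := by field_simp

theorem exists_clusters {κ : ℝ} (hκ : 0 < κ) (hsep : p.criticalSet.Pairwise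
      fun u w => κ ≤ ‖NormedSpace.normalize u - NormedSpace.normalize w‖) (D : ℝ) :
    ∃ κ', 0 < κ' ∧ ∀ ε, 0 < ε → ∃ δ, 0 < δ ∧ ∀ v w : UnitSphere d, p.reduced v ≤ D →
      p.reduced w ≤ D → p.reduced v - p.reduced (p.descend v) ≤ δ →
      p.reduced w - p.reduced (p.descend w) ≤ δ → dist v w < ε ∨ κ' ≤ dist v w := by
  obtain ⟨ρ, hρ, hnehari⟩ := p.exists_le_norm_of_nehari
  obtain ⟨R, hR, hbound⟩ := p.exists_norm_le_of_nehari D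
  have hgap_pos : 0 < min κ 1 * (ρ / R) := by positivity
  refine ⟨min κ 1 * (ρ / R) / 4, by positivity, fun ε hε => ?_⟩
  obtain ⟨δ, hδ, hnear⟩ := p.exists_dist_lt_or_lt_abs_sub hR hε
  obtain ⟨η, hη, hfar⟩ := p.exists_lt_dist_of_lt_abs_sub (κ := min κ 1 * (ρ / R) / 4) hδ
    fun v w a b ha hb hv hw hne => by
      linarith [p.mul_le_norm_sub_of_critical hκ hsep hR hnehari ha hb hv hw hne]
  obtain ⟨θ, hθ, hdefect⟩ := p.exists_defect_le D (lt_min hδ hη)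
  refine ⟨θ, hθ, fun v w hvD hwD hv hw => ?_⟩
  have hvR := hbound _ (p.nehari_lift v) hvD
  have hwR := hbound _ (p.nehari_lift w) hwD
  have hv' := le_min_iff.1 (hdefect v hvD hv)
  have hw' := le_min_iff.1 (hdefect w hwD hw)
  exact (hnear v w hvR hwR hv'.1 hw'.1).imp_right fun hx =>
    (hfar v w hvR hwR hv'.2 hw'.2 hx).le

end Problem

/-! ### Infinitely many critical orbits -/

theorem exists_orthonormal (hd : 1 ≤ d) : ∃ e : ℕ → Ell2 d, Orthonormal ℝ e := by
  classical
  have : Nonempty (Fin d) := ⟨⟨0, hd⟩⟩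
  let ι := Infinite.natEmbedding (Lattice d)
  refine ⟨fun n => lp.single 2 (ι n) (1 : ℝ), orthonormal_iff_ite.2 fun m n => ?_⟩
  rw [lp.inner_single_left, lp.single_apply]
  by_cases h : m = n
  · subst h
    simp
  · simp [h]

theorem normalize_shift (y : Lattice d) (u : Ell2 d) :
    NormedSpace.normalize (shift y u) = shift y (NormedSpace.normalize u) := by
  rw [NormedSpace.normalize, LinearIsometry.norm_map, ← map_smul, NormedSpace.normalize]

namespace Problem

variable (p : Problem d)

theorem defect_neg (u : Ell2 d) : p.defect (-u) = -p.defect u := by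
  rw [defect, map_neg, nonlin_neg, neg_sub_neg, ← neg_sub, defect]

theorem defect_lift_eq_zero {v : UnitSphere d} (hv : p.descend v = v) :
    p.defect (p.lift v) = 0 := by
  obtain ⟨r, hr, hloss⟩ := p.exists_descent_rate
  have hle := hloss v
  rw [hv, sub_self] at hle
  have hstep : (‖p.iter (p.lift v) - p.lift v‖ / ‖p.lift v‖) ^ 2 = 0 :=
    le_antisymm (nonpos_of_mul_nonpos_right hle hr) (sq_nonneg _)
  have hfixed : p.iter (p.lift v) = p.lift v := by
    simpa [sub_eq_zero, (p.nehari_lift v).1] using hstep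
  rw [defect, ← p.T_iter, hfixed, sub_self]

/-- The normalized fixed point iteration as a descent system, when the normalized critical points
are uniformly separated. -/
def descentSystem {κ : ℝ} (hκ : 0 < κ) (hsep : p.criticalSet.Pairwise
    fun u w => κ ≤ ‖NormedSpace.normalize u - NormedSpace.normalize w‖) :
    DescentSystem (UnitSphere d) where
  map := p.descend
  energy := p.reduced
  rate := Classical.choose p.exists_descent_rate / 4
  dist_neg v w := by
    rw [Subtype.dist_eq, Subtype.dist_eq, coe_neg_sphere, coe_neg_sphere, dist_neg_neg]
  continuous_map := p.continuous_descend
  continuous_energy := p.continuous_action.comp p.continuous_lift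
  map_neg := p.descend_neg
  energy_neg v := by rw [reduced, lift_neg, action_neg, reduced]
  energy_nonneg v := (p.nehari_lift v).action_nonneg
  rate_pos := div_pos (Classical.choose_spec p.exists_descent_rate).1 four_pos
  descent v := by
    obtain ⟨hr, hloss⟩ := Classical.choose_spec p.exists_descent_rate
    have hdist : dist (p.descend v) v ≤ 2 * (‖p.iter (p.lift v) - p.lift v‖ / ‖p.lift v‖) := by
      have hle := norm_normalize_sub_le (p.nehari_lift v).1 (p.iter (p.lift v))
      rw [p.normalize_lift] at hle
      rw [Subtype.dist_eq, dist_eq_norm]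
      exact hle
    calc Classical.choose p.exists_descent_rate / 4 * dist (p.descend v) v ^ 2
      _ ≤ Classical.choose p.exists_descent_rate / 4 *
          (2 * (‖p.iter (p.lift v) - p.lift v‖ / ‖p.lift v‖)) ^ 2 := by gcongr
      _ = Classical.choose p.exists_descent_rate *
          (‖p.iter (p.lift v) - p.lift v‖ / ‖p.lift v‖) ^ 2 := by ring
      _ ≤ p.reduced v - p.reduced (p.descend v) := hloss v
  clusters := p.exists_clusters hκ hsep

theorem exists_separation {F : Finset (Ell2 d)}
    (hF : ∀ u ∈ p.criticalSet, ∃ q ∈ F, ∃ y, u = shift y q) :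
    ∃ κ, 0 < κ ∧ p.criticalSet.Pairwise
      fun u w => κ ≤ ‖NormedSpace.normalize u - NormedSpace.normalize w‖ := by
  classical
  obtain ⟨κ, hκ, hsep⟩ := exists_separation_orbits (F.image NormedSpace.normalize)
  have hmem : ∀ u ∈ p.criticalSet, ∃ q ∈ F.image NormedSpace.normalize, ∃ y,
      NormedSpace.normalize u = shift y q := by
    intro u hu
    obtain ⟨q, hq, y, rfl⟩ := hF u hu
    exact ⟨_, Finset.mem_image_of_mem _ hq, y, normalize_shift y q⟩
  exact ⟨κ, hκ, fun u hu w hw hne => hsep (hmem u hu) (hmem w hw) fun heq =>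
    hne (eq_of_normalize_eq (nehari_of_mem_criticalSet hu) (nehari_of_mem_criticalSet hw) heq)⟩

theorem exists_mem_criticalSet_forall_ne_shift (hd : 1 ≤ d) (F : Finset (Ell2 d)) :
    ∃ u ∈ p.criticalSet, ∀ q ∈ F, ∀ y, u ≠ shift y q := by
  classical
  by_contra! hF
  obtain ⟨κ, hκ, hsep⟩ := p.exists_separation hF
  obtain ⟨e, he⟩ := exists_orthonormal hd
  have : CompleteSpace (UnitSphere d) := Metric.isClosed_sphere.completeSpace_coe
  have : FiniteDimensional ℝ (Submodule.span ℝ (e '' Iic (F.image p.action).card)) :=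
    FiniteDimensional.span_of_finite ℝ ((finite_Iic _).image e)
  refine not_genusLE_sphere he (F.image p.action).card
    ((p.descentSystem hκ hsep).genusLE (fun v hv => ne_neg_of_mem_unit_sphere ℝ v hv.symm)
      (fun v hv => ?_) (isCompact_sphere_submodule _)
      (fun v (hv : (v : Ell2 d) ∈ Submodule.span ℝ _) => Submodule.neg_mem _ hv)
      (Finset.card_filter_le _ _))
  obtain ⟨q, hq, y, hlift⟩ := hF (p.lift v) ⟨(p.nehari_lift v).1, p.defect_lift_eq_zero hv⟩
  refine Finset.mem_image.2 ⟨q, hq, ?_⟩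
  rw [← p.action_shift y, ← hlift]
  rfl

end Problem

/-! ### Geometric distinctness -/

theorem geometricallyDistinct_of_forall_ne_shift {u w : Ell2 d} (h : ∀ y, w ≠ shift y u) :
    GeometricallyDistinct u w := by
  refine Set.disjoint_left.2 ?_
  rintro _ ⟨y, rfl⟩ ⟨z, hz⟩
  refine h (y - z) (lp.ext (funext fun x => ?_))
  have hx : w (x + z - z) = u (x + z - y) := congrFun hz (x + z)
  rwa [add_sub_cancel_right, add_sub_right_comm, sub_add, ← shift_apply] at hx

theorem geometricallyDistinct_neg {u : Ell2 d} (hu : u ≠ 0) : GeometricallyDistinct u (-u) := by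
  refine geometricallyDistinct_of_forall_ne_shift fun y hy => ?_
  obtain ⟨x, hx⟩ := exists_apply_ne_zero hu
  have hshift : ∀ z, u (z - y) = -u z := fun z => congrArg (fun w : Ell2 d => w z) hy.symm
  have hy0 : y ≠ 0 := by
    rintro rfl
    exact hx (self_eq_neg.1 (by simpa using hshift x))
  have hperiodic : Function.Periodic (fun z => |u z|) y := fun z => by
    change |u (z + y)| = |u z|
    rw [← abs_neg, ← hshift, add_sub_cancel_right]
  -- `|u|` is periodic, hence equal to `|u x|` at infinitely many points.
  have hinjective : Function.Injective fun n : ℕ => x - n • y := fun m n h =>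
    Nat.cast_injective (smul_left_injective ℤ hy0 (by simpa using h))
  exact infinite_of_injective_forall_mem hinjective
    (fun n => (hperiodic.sub_nsmul_eq n).ge) (finite_setOf_le_abs u (abs_pos.2 hx))

theorem Problem.exists_seq_geometricallyDistinct (p : Problem d) (hd : 1 ≤ d) :
    ∃ u : ℕ → Ell2 d, (∀ n, u n ∈ p.criticalSet) ∧ ∀ m n, m ≠ n →
      GeometricallyDistinct (u m) (u n) ∧ GeometricallyDistinct (u m) (-u n) ∧
      GeometricallyDistinct (-u m) (u n) ∧ GeometricallyDistinct (-u m) (-u n) := by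
  classical
  let r (u w : Ell2 d) : Prop := GeometricallyDistinct u w ∧ GeometricallyDistinct u (-w) ∧
    GeometricallyDistinct (-u) w ∧ GeometricallyDistinct (-u) (-w)
  have : Std.Symm r :=
    ⟨fun _ _ h => ⟨h.1.symm, h.2.2.1.symm, h.2.1.symm, h.2.2.2.symm⟩⟩
  obtain ⟨u, hu, hdistinct⟩ := exists_seq_of_forall_finset_exists' (· ∈ p.criticalSet) r
    fun F _ => by
      obtain ⟨w, hw, hne⟩ :=
        p.exists_mem_criticalSet_forall_ne_shift hd (F ∪ F.image Neg.neg)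
      have hne_self : ∀ q ∈ F, ∀ y, w ≠ shift y q := fun q hq =>
        hne q (Finset.mem_union_left _ hq)
      have hne_neg : ∀ q ∈ F, ∀ y, w ≠ shift y (-q) := fun q hq =>
        hne (-q) (Finset.mem_union_right _ (Finset.mem_image_of_mem _ hq))
      refine ⟨w, hw, fun q hq => ⟨?_, ?_, ?_, ?_⟩⟩ <;>
        refine geometricallyDistinct_of_forall_ne_shift fun y => ?_
      · exact hne_self q hq y
      · rw [← neg_injective.ne_iff, neg_neg, ← map_neg]
        exact hne_neg q hq y
      · exact hne_neg q hq y
      · rw [map_neg, neg_injective.ne_iff]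
        exact hne_self q hq y
  exact ⟨u, hu, fun m n hne => hdistinct hne⟩

/-! ### The nonlinearity -/

theorem eq_of_periodic {β : Type*} {φ : Lattice d → β}
    (h : ∀ i, Function.Periodic φ (Pi.single i 1)) (x : Lattice d) : φ x = φ 0 := by
  have hperiod : Function.Periodic φ (∑ i, x i • Pi.single i 1) :=
    Finset.sum_induction _ (Function.Periodic φ) (fun _ _ => Function.Periodic.add_period)
      (Function.periodic_with_period_zero φ) fun i _ => (h i).zsmul (x i)
  have hsum : ∑ i, x i • Pi.single i (1 : ℤ) = x := by
    simp only [← Pi.single_smul, smul_eq_mul, mul_one, Finset.univ_sum_single]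
  rw [← hperiod.eq, hsum]

section Nonlinearity

variable {f : ℝ → ℝ}

theorem div_self_mul (h0 : f 0 = 0) (s : ℝ) : f s / s * s = f s := by
  obtain rfl | hs := eq_or_ne s 0
  · rw [h0, mul_zero]
  · exact div_mul_cancel₀ _ hs

theorem continuous_quotient (hf : Continuous f) (hlittleO : f =o[𝓝 0] fun s => s) :
    Continuous fun s => f s / s := by
  refine continuous_iff_continuousAt.2 fun s => ?_
  obtain rfl | hs := eq_or_ne s 0
  · simpa [ContinuousAt] using hlittleO.tendsto_div_nhds_zero
  · exact hf.continuousAt.div continuousAt_id hs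

theorem strictMonoOn_Ici_of_Ioi {φ : ℝ → ℝ} {a : ℝ} (hφ : ContinuousWithinAt φ (Ioi a) a)
    (hmono : StrictMonoOn φ (Ioi a)) : StrictMonoOn φ (Ici a) := by
  intro s hs t _ hst
  obtain rfl | has := (mem_Ici.1 hs).eq_or_lt
  · obtain ⟨r, hsr, hrt⟩ := exists_between hst
    refine (le_of_tendsto hφ ?_).trans_lt (hmono hsr hst hrt)
    filter_upwards [Ioo_mem_nhdsGT hsr] with x hx
    exact (hmono hx.1 hsr hx.2).le
  · exact hmono has (has.trans hst) hst

theorem le_integral_of_monotoneOn_quotient (hf : Continuous f) (h0 : f 0 = 0)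
    (hmono : MonotoneOn (fun s => f s / s) (Ici 0)) {a b : ℝ} (ha : 0 ≤ a) (hb : 0 ≤ b) :
    f a / a * (b ^ 2 - a ^ 2) / 2 ≤ ∫ t in a..b, f t := by
  have hint : ∀ x y, IntervalIntegrable f volume x y := hf.intervalIntegrable
  have hint_line : ∀ x y, IntervalIntegrable (fun t => f a / a * t) volume x y :=
    (continuous_const.mul continuous_id).intervalIntegrable
  have hline : f a / a * (b ^ 2 - a ^ 2) / 2 = ∫ t in a..b, f a / a * t := by
    rw [intervalIntegral.integral_const_mul, integral_id, mul_div_assoc]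
  rw [hline]
  obtain hab | hba := le_total a b
  · refine intervalIntegral.integral_mono_on hab (hint_line _ _) (hint _ _) fun t ht => ?_
    rw [← div_self_mul h0 t]
    exact mul_le_mul_of_nonneg_right (hmono ha (ha.trans ht.1) ht.1) (ha.trans ht.1)
  · rw [intervalIntegral.integral_symm b, intervalIntegral.integral_symm b, neg_le_neg_iff]
    refine intervalIntegral.integral_mono_on hba (hint _ _) (hint_line _ _) fun t ht => ?_
    rw [← div_self_mul h0 t]
    exact mul_le_mul_of_nonneg_right (hmono (hb.trans ht.1) ha ht.2) (hb.trans ht.1)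

theorem integral_abs_of_odd (hodd : Function.Odd f) (s : ℝ) :
    ∫ t in (0 : ℝ)..|s|, f t = ∫ t in (0 : ℝ)..s, f t := by
  obtain h | h := abs_choice s
  · rw [h]
  · have hreflect := intervalIntegral.integral_comp_neg (a := s) (b := 0) f
    simp only [hodd.eq, intervalIntegral.integral_neg, neg_zero] at hreflect
    rw [h, ← hreflect, intervalIntegral.integral_symm, neg_neg]

theorem le_integral_sub_integral (hf : Continuous f) (hodd : Function.Odd f)
    (hmono : MonotoneOn (fun s => f s / s) (Ici 0)) (a b : ℝ) :
    f a / a * (b ^ 2 - a ^ 2) / 2 ≤ (∫ t in (0 : ℝ)..b, f t) - ∫ t in (0 : ℝ)..a, f t := by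
  have hquotient : f |a| / |a| = f a / a := by
    obtain h | h := abs_choice a <;> rw [h]
    rw [hodd.eq, neg_div_neg_eq]
  have hle := le_integral_of_monotoneOn_quotient hf hodd.map_zero hmono (abs_nonneg a)
    (abs_nonneg b)
  rwa [hquotient, sq_abs, sq_abs, ← intervalIntegral.integral_interval_sub_left
    (hf.intervalIntegrable _ _) (hf.intervalIntegrable _ _), integral_abs_of_odd hodd,
    integral_abs_of_odd hodd] at hle

/-- The variational problem for `(-Δ)^α u + c u = f(u)`. -/
def Problem.ofNonlinearity {α : ℝ} (hα : 0 ≤ α) {c : ℝ} (hc : 0 < c) (hf : Continuous f)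
    (hodd : Function.Odd f) (hlittleO : f =o[𝓝 0] fun s => s)
    (hmono : StrictMonoOn (fun s => f s / s) (Ioi 0))
    (hsuper : ∀ M : ℝ, ∃ R, 0 < R ∧ ∀ u, R < |u| → M ≤ (∫ t in (0 : ℝ)..u, f t) / u ^ 2) :
    Problem d where
  T := laplacian hα + c • ContinuousLinearMap.id ℝ (Ell2 d)
  c := c
  g s := f s / s
  prim u := ∫ t in (0 : ℝ)..u, f t
  c_pos := hc
  T_symm u w := by
    simp [inner_add_left, inner_add_right, inner_smul_left, inner_smul_right,
      inner_laplacian_comm]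
  T_coercive u := by
    simpa [inner_add_left, inner_smul_left] using inner_laplacian_self_nonneg hα u
  T_shift y u := by simp [laplacian_shift]
  g_continuous := continuous_quotient hf hlittleO
  g_neg s := by rw [hodd.eq, neg_div_neg_eq]
  g_zero := div_zero _
  g_strictMono :=
    strictMonoOn_Ici_of_Ioi (continuous_quotient hf hlittleO).continuousWithinAt hmono
  prim_zero := intervalIntegral.integral_same
  prim_sub := le_integral_sub_integral hf hodd (strictMonoOn_Ici_of_Ioi
    (continuous_quotient hf hlittleO).continuousWithinAt hmono).monotoneOn
  prim_superquadratic M := by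
    obtain ⟨R, hR, hle⟩ := hsuper M
    refine ⟨R, hR, fun s hs => ?_⟩
    have hs_ne : s ≠ 0 := abs_pos.1 (hR.trans hs)
    exact (le_div_iff₀ (by positivity)).1 (hle s hs)

theorem isSolution_of_defect_eq_zero {α : ℝ} (hα : 0 ≤ α) {c : ℝ} (hc : 0 < c)
    (hf : Continuous f) (hodd : Function.Odd f) (hlittleO : f =o[𝓝 0] fun s => s)
    (hmono : StrictMonoOn (fun s => f s / s) (Ioi 0))
    (hsuper : ∀ M : ℝ, ∃ R, 0 < R ∧ ∀ u, R < |u| → M ≤ (∫ t in (0 : ℝ)..u, f t) / u ^ 2)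
    {u : Ell2 d}
    (hu : (Problem.ofNonlinearity hα hc hf hodd hlittleO hmono hsuper).defect u = 0) :
    IsSolution α (fun _ => c) (fun _ => f) u := by
  intro x
  have hx : laplacian hα u x + c * u x - f (u x) / u x * u x = 0 :=
    congrArg (fun w : Ell2 d => w x) hu
  rw [div_self_mul hodd.map_zero, sub_eq_zero] at hx
  rw [fracLaplacian_eq_laplacian hα, ← Complex.ofReal_add, hx]

end Nonlinearity

end DiscreteFractional

end

open DiscreteFractional Topology in
theorem theorem1p2_general (d : ℕ) (hd : 1 ≤ d) (α : ℝ) (hα : 0 ≤ α)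
    (h : Lattice d → ℝ) (f : Lattice d → ℝ → ℝ)
    (h_pos : ∀ x, 0 < h x)
    (f1 : ∀ x, Continuous (f x))
    (f3 : ∀ ε : ℝ, 0 < ε → ∃ δ : ℝ, 0 < δ ∧ ∀ x u, |u| < δ → |f x u| ≤ ε * |u|)
    (f4 : ∀ x, StrictMonoOn (fun u : ℝ => f x u / |u|) (Ioi 0))
    (f5 : ∀ M : ℝ, ∃ R : ℝ, 0 < R ∧ ∀ x u, R < |u| → M ≤ (∫ t in (0 : ℝ)..u, f x t) / u ^ 2)
    (f6 : ∀ (i : Fin d) (x : Lattice d),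
      h (x + Pi.single i 1) = h x ∧ ∀ u : ℝ, f (x + Pi.single i 1) u = f x u)
    (f_odd : ∀ x u, f x (-u) = -f x u) :
    ∃ u : ℕ → Ell2 d,
      (∀ n, u n ≠ 0 ∧
        u n ∈ HAlpha α h ∧ IsSolution α h f (u n) ∧
        -u n ∈ HAlpha α h ∧ IsSolution α h f (-u n) ∧
        GeometricallyDistinct (u n) (-u n)) ∧
      ∀ m n, m ≠ n →
        GeometricallyDistinct (u m) (u n) ∧
        GeometricallyDistinct (u m) (-u n) ∧
        GeometricallyDistinct (-u m) (u n) ∧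
        GeometricallyDistinct (-u m) (-u n) := by
  obtain ⟨c, rfl⟩ : ∃ c, h = fun _ => c :=
    ⟨h 0, funext (eq_of_periodic fun i x => (f6 i x).1)⟩
  obtain ⟨g, rfl⟩ : ∃ g, f = fun _ => g :=
    ⟨f 0, funext (eq_of_periodic fun i x => funext (f6 i x).2)⟩
  have hlittleO : g =o[𝓝 0] fun s => s := Asymptotics.isLittleO_iff.2 fun ε hε => by
    obtain ⟨δ, hδ, hle⟩ := f3 ε hε
    exact Metric.eventually_nhds_iff.2 ⟨δ, hδ, fun u hu => hle 0 u (by simpa using hu)⟩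
  have hmono : StrictMonoOn (fun s => g s / s) (Ioi 0) :=
    (f4 0).congr fun s hs => congrArg (g s / ·) (abs_of_pos hs)
  have hsuper (M : ℝ) := (f5 M).imp fun R hR => And.imp_right (fun hle => hle 0) hR
  have hmem : ∀ u, u ∈ HAlpha α fun _ : Lattice d => c := mem_HAlpha hα fun _ => le_rfl
  have hsolution {u : Ell2 d} := isSolution_of_defect_eq_zero (u := u) hα (h_pos 0) (f1 0)
    (f_odd 0) hlittleO hmono hsuper
  obtain ⟨u, hu, hdistinct⟩ := (Problem.ofNonlinearity hα (h_pos 0) (f1 0)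
    (f_odd 0) hlittleO hmono hsuper).exists_seq_geometricallyDistinct hd
  refine ⟨u, fun n => ⟨(hu n).1, hmem _, hsolution (hu n).2, hmem _, hsolution ?_,
    geometricallyDistinct_neg (hu n).1⟩, hdistinct⟩
  rw [Problem.defect_neg, (hu n).2, neg_zero]

theorem theorem1p2 (d : ℕ) (hd : 1 ≤ d) (α : ℝ) (hα0 : 0 < α) (hα1 : α < 1)
    (h : DiscreteFractional.Lattice d → ℝ) (f : DiscreteFractional.Lattice d → ℝ → ℝ)
    -- (h1)
    (h1 : ∃ c₁ c₂ : ℝ, 0 < c₁ ∧ 0 < c₂ ∧ ∀ x, c₁ ≤ h x ∧ h x ≤ c₂)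
    -- (f1)
    (f1 : ∀ x, Continuous (f x))
    -- (f2)
    (f2 : ∃ a p : ℝ, 0 < a ∧ 2 < p ∧ ∀ x u, |f x u| ≤ a * (1 + |u| ^ (p - 1)))
    -- (f3)
    (f3 : ∀ ε : ℝ, 0 < ε → ∃ δ : ℝ, 0 < δ ∧ ∀ x u, |u| < δ → |f x u| ≤ ε * |u|)
    -- (f4)
    (f4 : ∀ x, StrictMonoOn (fun u : ℝ => f x u / |u|) (Set.Iio 0) ∧
      StrictMonoOn (fun u : ℝ => f x u / |u|) (Set.Ioi 0))
    -- (f5)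
    (f5 : ∀ M : ℝ, ∃ R : ℝ, 0 < R ∧ ∀ x u, R < |u| → M ≤ (∫ t in (0 : ℝ)..u, f x t) / u ^ 2)
    -- (f6)
    (f6 : ∀ (i : Fin d) (x : DiscreteFractional.Lattice d),
      h (x + Pi.single i 1) = h x ∧ ∀ u : ℝ, f (x + Pi.single i 1) u = f x u)
    (f_odd : ∀ x u, f x (-u) = -f x u) :
    ∃ u : ℕ → DiscreteFractional.Ell2 d,
      (∀ n, u n ≠ 0 ∧
        u n ∈ DiscreteFractional.HAlpha α h ∧ DiscreteFractional.IsSolution α h f (u n) ∧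
        -u n ∈ DiscreteFractional.HAlpha α h ∧ DiscreteFractional.IsSolution α h f (-u n) ∧
        DiscreteFractional.GeometricallyDistinct (u n) (-u n)) ∧
      ∀ m n, m ≠ n →
        DiscreteFractional.GeometricallyDistinct (u m) (u n) ∧
        DiscreteFractional.GeometricallyDistinct (u m) (-u n) ∧
        DiscreteFractional.GeometricallyDistinct (-u m) (u n) ∧
        DiscreteFractional.GeometricallyDistinct (-u m) (-u n) :=
  theorem1p2_general d hd α hα0.le h f
    (fun x => h1.elim fun _ ⟨_, hpos, _, hle⟩ => hpos.trans_le (hle x).1)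
    f1 f3 (fun x => (f4 x).2) f5 f6 f_odd
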